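/- **Setting.** Let $\mathbb F$ be a field, $f:\mathbb F^m\to\mathbb F^u$ a polynomial map of degree $d\ge 1$ (the maximal order of its monomials), and let $N$ (workers), $S<N$ (stragglers) and $L\ge 0$ (colluders) be integers. The field is sufficiently large: its characteristic is $0$ or larger than $d$, it has at least $2N$ elements, and it is finite if $L>0$ (so that uniform noise exists). A *linear coded computing scheme* for $K\ge1$ data blocks $D_0,\dots,D_{K-1}\in\mathbb F^m$ sends to worker $n$ the block $\widetilde D_n=\sum_k G_{n,k}D_k+\widetilde Z_n$ with $\widetilde Z_n=\sum_t H_{n,t}Z_t$, where $G_{n,k},H_{n,t}\in\mathbb F$ are constants and the $Z_t$ are random blocks, uniform on $\mathbb F^m$, independent of each other and of the data. Worker $n$ returns $f(\widetilde D_n)$. The scheme is *feasible* for $(N,S,L,f)$ if * for every set of $N-S$ workers, some fixed linear map recovers $f(D_0),\dots,f(D_{K-1})$ from their results, for all values of the data and of the noise; and * for every set $\mathcal L$ of at most $L$ workers, the mutual information of $(D_0,\dots,D_{K-1})$ and $(\widetilde D_n)_{n\in\mathcal L}$ is $0$, for every distribution of the data. Its encoding rate is $K/(N-S)$. The *capacity*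 $C$ is the supremum of the encoding rates of all feasible linear schemes (over all $K\ge1$). APCC with $K$ data blocks is the scheme $\widetilde D_n=g(\beta_n)$, where $g$ is the polynomial of degree less than $K+L$ with $g(\alpha_k)=D_k$ for $k<K$ and $g(\alpha_{K+t})=Z_t$ for $t<L$. Here the $\alpha_j$ are distinct, the $\beta_n$ are distinct, and if $L>0$ no $\beta_n$ equals an $\alpha_k$ with $k<K$. Its decoder interpolates the received results at the points $\beta_n$ and evaluates at $\alpha_0,\dots,\alpha_{K-1}$. If $L=0$ there is also the uncoded version $\beta_n=\alpha_{n\bmod K}$, in which worker $n$ holds $D_{n\bmod K}$. **Theorem 1.** Put $$C_0=\begin{cases}\dfrac{N-S-d(L-1)-1}{d(N-S)}, & L>0,\\[2mm] \max\Bigl\{\dfrac{N-S+d-1}{d(N-S)},\ \dfrac{N}{(N-S)(S+1)}\Bigr\}, & L=0.\end{cases}$$ If $N\ge S+dL+1$, then $$C=\frac{\lfloor (N-S)\,C_0\rfloor}{N-S},$$ that is, $C$ is $C_0$ rounded down to a multiple of $1/(N-S)$. In particular $C=C_0$ if and only if $(N-S)C_0$ is an integer. The supremum is attained, and it is attained by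 APCC, for every choice of the points above (such points exist) if the coded version is used, and for every choice of distinct nodes if $L=0$ and the uncoded version is used. So APCC is rate-optimal. If $N<S+dL+1$, no feasible linear scheme exists. -/

import Mathlib

open scoped ENNReal BigOperators

noncomputable section

namespace CodedComputing

/-- Shannon mutual information `I(X;Y)` of a pair with joint law `p`: the Kullback-Leibler
divergence of the joint law from the product of its two marginals. -/
def mutualInfo {α β : Type*} (p : PMF (α × β)) : ℝ≥0∞ :=
  letI : MeasurableSpace α := ⊤
  letI : MeasurableSpace β := ⊤
  InformationTheory.klDiv p.toMeasure
    ((p.map Prod.fst).toMeasure.prod (p.map Prod.snd).toMeasure)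

variable {F : Type*} [Field F] {ι κ : Type*} {N K : ℕ}

/-- The polynomial function `F^ι → F^κ` with components `f`. -/
def polyFun (f : κ → MvPolynomial ι F) (x : ι → F) : κ → F :=
  fun i => MvPolynomial.eval x (f i)

/-- The degree of a tuple of polynomials: the maximal order of the monomials that occur. -/
def polyDegree [Fintype κ] (f : κ → MvPolynomial ι F) : ℕ :=
  Finset.univ.sup fun i => (f i).totalDegree

/-- A linear encoding of `K` data blocks for `N` workers: worker `n` receives a linear combination
of the data blocks (row `n` of `G`) plus the additive noise that is the linear combination
(row `n` of `H`) of `keys` random blocks. -/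
structure LinearScheme (F : Type*) (N K : ℕ) where
  /-- the number of random blocks -/
  keys : ℕ
  /-- the encoding matrix -/
  G : Matrix (Fin N) (Fin K) F
  /-- the coefficients of the additive randomness -/
  H : Matrix (Fin N) (Fin keys) F

namespace LinearScheme

/-- The block sent to worker `n` for the data `D` and the random blocks `Z`. -/
def encode (s : LinearScheme F N K) (D : Fin K → ι → F) (Z : Fin s.keys → ι → F) (n : Fin N) :
    ι → F :=
  ∑ k, s.G n k • D k + ∑ t, s.H n t • Z t

/-- A linear decoder: for each set `R` of responding workers, a linear map that takes the results
of these workers to (candidates for) the `K` desired results. It does not see the noise. -/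
abbrev Decoder (F : Type*) [Field F] (κ : Type*) (N K : ℕ) :=
  (R : Finset (Fin N)) → (R → κ → F) →ₗ[F] (Fin K → κ → F)

/-- With the decoder `dec`, the values of `f` at all data blocks are recovered from the results of
any `N - S` workers, whatever the data and the noise are. -/
def RecoversWith (s : LinearScheme F N K) (f : κ → MvPolynomial ι F) (S : ℕ)
    (dec : Decoder F κ N K) : Prop :=
  ∀ R : Finset (Fin N), R.card = N - S → ∀ (D : Fin K → ι → F) (Z : Fin s.keys → ι → F),
    dec R (fun n => polyFun f (s.encode D Z n)) = fun k => polyFun f (D k)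

/-- The joint law of the data and of the blocks held by the workers in `A`, when the data have
the law `prior` and the random blocks are independent of them, uniform and independent. -/
def jointLaw [Finite F] [Finite ι] (s : LinearScheme F N K) (A : Finset (Fin N))
    (prior : PMF (Fin K → ι → F)) : PMF ((Fin K → ι → F) × (A → ι → F)) :=
  letI : Fintype (Fin s.keys → ι → F) := Fintype.ofFinite _
  prior.bind fun D =>
    (PMF.uniformOfFintype (Fin s.keys → ι → F)).map fun Z => (D, fun n => s.encode D Z n)

/-- Perfect privacy against any (at most) `L` colluding workers: what they hold has zero mutual
information with the data, whatever the law of the data. As soon as there can be a colluder,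
this requires the uniform law of the random blocks to exist, that is, a finite field. -/
def IsPrivate (ι : Type*) [Finite ι] (s : LinearScheme F N K) (L : ℕ) : Prop :=
  ∀ A : Finset (Fin N), A.Nonempty → A.card ≤ L →
    ∃ _ : Finite F, ∀ prior : PMF (Fin K → ι → F), mutualInfo (s.jointLaw A prior) = 0

/-- The scheme solves the `(N, S, L, f)` problem: linear decoding in the presence of `S`
stragglers, and privacy against `L` colluders. -/
def IsFeasible [Finite ι] (s : LinearScheme F N K) (f : κ → MvPolynomial ι F) (S L : ℕ) : Prop :=
  (∃ dec : Decoder F κ N K, s.RecoversWith f S dec) ∧ s.IsPrivate ι L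

end LinearScheme

/-- The encoding rates `K / (N - S)` of the feasible linear schemes. -/
def encodingRates [Finite ι] (f : κ → MvPolynomial ι F) (N S L : ℕ) : Set ℝ :=
  {r | ∃ (K : ℕ) (s : LinearScheme F N K), 0 < K ∧ s.IsFeasible f S L ∧
    r = (K : ℝ) / ((N : ℝ) - S)}

/-- The capacity: the supremum of the encoding rates. -/
def capacity [Finite ι] (f : κ → MvPolynomial ι F) (N S L : ℕ) : ℝ :=
  sSup (encodingRates f N S L)

/-- The APCC encoding with nodes `α` and evaluation points `β`: `g` is the polynomial of degree
`< K + L` with the values `D 0, …, D (K-1), Z 0, …, Z (L-1)` at the nodes, and worker `n` receives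
`g (β n)`. The coefficients are the Lagrange basis polynomials, whose barycentric form is
`(w_j / (x - α_j)) / ∑ k, w_k / (x - α_k)`, `w_j = 1 / ∏_{k ≠ j} (α_j - α_k)`. -/
def apcc {L : ℕ} (α : Fin (K + L) → F) (β : Fin N → F) : LinearScheme F N K where
  keys := L
  G := fun n k => (Lagrange.basis Finset.univ α (Fin.castAdd L k)).eval (β n)
  H := fun n t => (Lagrange.basis Finset.univ α (Fin.natAdd K t)).eval (β n)

/-- The APCC decoder: interpolate the received results at the points `β n` and evaluate at the
nodes of the data. -/
def apccDecoder {L : ℕ} (κ : Type*) (α : Fin (K + L) → F) (β : Fin N → F) :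
    LinearScheme.Decoder F κ N K :=
  fun R => LinearMap.pi fun k => ∑ n : R,
    (Lagrange.basis R β (n : Fin N)).eval (α (Fin.castAdd L k)) •
      (LinearMap.proj n : (R → κ → F) →ₗ[F] (κ → F))

/-- Admissible points for APCC: the nodes are distinct, the evaluation points are distinct, and
with colluders no evaluation point is the node of a data block. -/
def ApccPoints {L : ℕ} (α : Fin (K + L) → F) (β : Fin N → F) : Prop :=
  Function.Injective α ∧ Function.Injective β ∧
    (0 < L → ∀ (n : Fin N) (k : Fin K), β n ≠ α (Fin.castAdd L k))

/-- The evaluation points of uncoded APCC (no colluders): the data nodes, used cyclically, so that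
worker `n` receives the data block with index `n mod K`. -/
def uncodedPoints (N : ℕ) (hK : 0 < K) (α : Fin (K + 0) → F) : Fin N → F :=
  fun n => α (Fin.castAdd 0 ⟨(n : ℕ) % K, Nat.mod_lt _ hK⟩)

/-- APCC solves the `(N, S, L, f)` problem with `K` data blocks: either in its coded version, with
all admissible points (and there are some) and the interpolation decoder, or, if there are no
colluders, in its uncoded version. -/
def ApccSolves [Finite ι] (f : κ → MvPolynomial ι F) (N S L K : ℕ) : Prop :=
  ((∃ (α : Fin (K + L) → F) (β : Fin N → F), ApccPoints α β) ∧
    ∀ (α : Fin (K + L) → F) (β : Fin N → F), ApccPoints α β →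
      (apcc α β).RecoversWith f S (apccDecoder κ α β) ∧ (apcc α β).IsPrivate ι L) ∨
  (L = 0 ∧ ∃ hK : 0 < K, (∃ α : Fin (K + 0) → F, Function.Injective α) ∧
    ∀ α : Fin (K + 0) → F, Function.Injective α →
      (apcc α (uncodedPoints N hK α)).IsFeasible f S 0)

/-- The closed form `C₀` of the capacity, up to rounding. -/
def capacityFormula (N S L d : ℕ) : ℝ :=
  if 0 < L then ((N : ℝ) - S - d * ((L : ℝ) - 1) - 1) / (d * ((N : ℝ) - S))
  else max (((N : ℝ) - S + d - 1) / (d * ((N : ℝ) - S)))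
    ((N : ℝ) / (((N : ℝ) - S) * ((S : ℝ) + 1)))

end CodedComputing

end

/-! Converse. Put data and noise on a line through the origin along which the top-degree part of
some component of `f` survives. The inputs are then parametrised by linear functionals on the space
of encoding vectors, and each worker returns a univariate polynomial in the value of the functional
at its vector. A mixed difference of order `d` turns that polynomial into a constant times the
product of the values of `d` functionals. Linear decoding commutes with differences. Hence, if every
responding worker is killed by one of these functionals, so is the vector of each data block. So
functionals missing the vector of a data block must be nonzero together at more than `S` workers
(`uncoverable_of_recoversWith`). The rest is matroid covering. If `d` hyperplanes missing `p` cannot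
cover a family up to fewer than `s` members, Rado's argument gives a subfamily that is large
compared with its rank modulo `p`. Passing to quotients by the spans of such subfamilies bounds the
whole family from below: `card_ge_of_uncoverable_span` without privacy, and
`card_ge_of_uncoverable_private`, where privacy adds `L` to the dimension to be paid for.
Achievability. The composite of `f` with the encoding polynomial has degree at most `d * (K + L -
1)`, so enough results interpolate it. Privacy holds because suitable noise makes the blocks of any
`L` workers zero whatever the data are, and uniform noise is translation invariant. Without
colluders, cyclic repetition gives the second term of the maximum. Both sides meet at the same
integer `K`. -/

noncomputable section

namespace CodedComputing

/-! ### Matroid covering: families that few hyperplanes cannot cover are large. -/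

section Covering

open Finset Module

/-- Rado's argument: if a family of sets `B i` satisfies a Hall-type condition for a monotone
submodular function `r`, it can be shrunk to a pairwise disjoint family that still satisfies it
for the full set. -/
theorem exists_pairwiseDisjoint_card_le_sum {η τ : Type*} [DecidableEq η] [Fintype τ]
    (r : Finset η → ℕ) (hmono : Monotone r)
    (hsub : ∀ X Y, r (X ∪ Y) + r (X ∩ Y) ≤ r X + r Y) (E : Finset η) (δ : ℕ)
    (B : τ → Finset η) (hB : ∀ X ⊆ E, X.card ≤ δ + ∑ i, r (X ∩ B i)) :
    ∃ B' : τ → Finset η, (∀ i, B' i ⊆ E) ∧ Pairwise (fun i j => Disjoint (B' i) (B' j)) ∧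
      E.card ≤ δ + ∑ i, r (B' i) := by
  classical
  induction hm : ∑ i, (B i).card using Nat.strong_induction_on generalizing B with
  | _ m ih =>
  by_cases hdis : Pairwise (fun i j => Disjoint (B i) (B j))
  · refine ⟨fun i => E ∩ B i, fun i => inter_subset_left, fun i j hij => ?_, hB E subset_rfl⟩
    exact (hdis hij).mono inter_subset_right inter_subset_right
  obtain ⟨i, j, hij, n, hni, hnj⟩ : ∃ i j, i ≠ j ∧ ∃ n, n ∈ B i ∧ n ∈ B j := by
    simp only [Pairwise, not_forall, Finset.not_disjoint_iff] at hdis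
    obtain ⟨i, j, hij, n, h⟩ := hdis
    exact ⟨i, j, hij, n, h⟩
  have key : ∀ l, n ∈ B l →
      (∀ X ⊆ E, X.card ≤ δ + ∑ i, r (X ∩ Function.update B l ((B l).erase n) i)) →
      ∃ B' : τ → Finset η, (∀ i, B' i ⊆ E) ∧ Pairwise (fun i j => Disjoint (B' i) (B' j)) ∧
        E.card ≤ δ + ∑ i, r (B' i) := by
    intro l hl h
    refine ih _ ?_ _ h rfl
    rw [← hm]
    refine sum_lt_sum (fun k _ => ?_) ⟨l, mem_univ _, ?_⟩
    · by_cases hk : k = l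
      · subst hk; simpa using card_le_card (erase_subset _ _)
      · simp [hk]
    · simpa using card_lt_card (erase_ssubset hl)
  by_contra hcon
  have hX := mt (key i hni) hcon
  have hY := mt (key j hnj) hcon
  push Not at hX hY
  obtain ⟨X, hXE, hX⟩ := hX
  obtain ⟨Y, hYE, hY⟩ := hY
  have hnX : n ∈ X := by
    by_contra hn
    refine absurd (hB X hXE) (not_le.mpr (lt_of_le_of_lt ?_ hX))
    gcongr with k
    by_cases hk : k = i
    · subst hk
      refine hmono fun x hx => ?_
      simp only [mem_inter, Function.update_self, mem_erase] at hx ⊢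
      exact ⟨hx.1, fun h => hn (h ▸ hx.1), hx.2⟩
    · simp [hk]
  have hnY : n ∈ Y := by
    by_contra hn
    refine absurd (hB Y hYE) (not_le.mpr (lt_of_le_of_lt ?_ hY))
    gcongr with k
    by_cases hk : k = j
    · subst hk
      refine hmono fun x hx => ?_
      simp only [mem_inter, Function.update_self, mem_erase] at hx ⊢
      exact ⟨hx.1, fun h => hn (h ▸ hx.1), hx.2⟩
    · simp [hk]
  -- Both erasures fail strictly, at `X` and at `Y`, a loss of two. Submodularity transfers this to
  -- `X ∪ Y` and `(X ∩ Y).erase n`, whose sizes fall short of `|X| + |Y|` by only one.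
  have hU := hB (X ∪ Y) (union_subset hXE hYE)
  have hI := hB ((X ∩ Y).erase n)
    ((erase_subset _ _).trans (inter_subset_left.trans hXE))
  have hterm : ∀ k, r ((X ∪ Y) ∩ B k) + r ((X ∩ Y).erase n ∩ B k) ≤
      r (X ∩ Function.update B i ((B i).erase n) k) +
        r (Y ∩ Function.update B j ((B j).erase n) k) := by
    intro k
    refine le_trans (add_le_add (hmono ?_) (hmono ?_)) (hsub _ _)
    · intro x hx
      simp only [mem_inter, mem_union] at hx ⊢
      by_cases hki : k = i
      · subst hki
        rw [Function.update_self, Function.update_of_ne hij]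
        simp only [mem_erase]
        by_cases hxn : x = n
        · subst hxn; exact Or.inr ⟨hnY, hx.2⟩
        · tauto
      · rw [Function.update_of_ne hki]
        by_cases hkj : k = j
        · subst hkj
          rw [Function.update_self]
          simp only [mem_erase]
          by_cases hxn : x = n
          · subst hxn; exact Or.inl ⟨hnX, hx.2⟩
          · tauto
        · rw [Function.update_of_ne hkj]; tauto
    · intro x hx
      simp only [mem_inter, mem_erase] at hx ⊢
      have h1 : ∀ l, x ∈ Function.update B l ((B l).erase n) k := by
        intro l
        by_cases hkl : k = l
        · subst hkl; rw [Function.update_self]; exact mem_erase.mpr ⟨hx.1.1, hx.2⟩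
        · rw [Function.update_of_ne hkl]; exact hx.2
      exact ⟨⟨hx.1.2.1, h1 i⟩, hx.1.2.2, h1 j⟩
  have hsum := sum_le_sum fun k (_ : k ∈ (univ : Finset τ)) => hterm k
  rw [sum_add_distrib, sum_add_distrib] at hsum
  have hc := card_union_add_card_inter X Y
  have he := card_erase_add_one (mem_inter.mpr ⟨hnX, hnY⟩)
  omega

variable {F V η : Type*} [Field F] [AddCommGroup V] [Module F V]

open Classical in
/-- Any `d` linear functionals that do not vanish at `p` leave at least `s` members of the family
`g` on `E` at which none of them vanishes. -/
def Uncoverable (d s : ℕ) (E : Finset η) (g : η → V) (p : V) : Prop :=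
  ∀ l : Fin d → Dual F V, (∀ i, l i p ≠ 0) → s ≤ (E.filter fun n => ∀ i, l i (g n) ≠ 0).card

theorem Uncoverable.mono_set {d s : ℕ} {E E' : Finset η} {g : η → V} {p : V}
    (h : Uncoverable (F := F) d s E g p)
    (hE : ∀ n ∈ E, ∀ l : Fin d → Dual F V, (∀ i, l i (g n) ≠ 0) → n ∈ E') :
    Uncoverable (F := F) d s E' g p := by
  classical
  intro l hl
  refine (h l hl).trans (card_le_card fun n hn => ?_)
  simp only [mem_filter] at hn ⊢
  exact ⟨hE n hn.1 l hn.2, hn.2⟩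

theorem Uncoverable.map {V' : Type*} [AddCommGroup V'] [Module F V'] {d s : ℕ} {E : Finset η}
    {g : η → V} {p : V} (h : Uncoverable (F := F) d s E g p) (q : V →ₗ[F] V') :
    Uncoverable (F := F) d s E (fun n => q (g n)) (q p) :=
  fun l hl => h (fun i => (l i).comp q) hl

/-- A hyperplane missing `p` that contains as many members of the family as the rank modulo `p`
allows. -/
theorem exists_dual_card_zeros [FiniteDimensional F V] (g : η → V) {p : V} (hp : p ≠ 0)
    (B : Finset η) :
    ∃ l : Dual F V, l p ≠ 0 ∧ ∃ I ⊆ B, (∀ n ∈ I, l (g n) = 0) ∧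
      finrank F ↥(Submodule.span F (g '' B) ⊔ Submodule.span F {p}) ≤ I.card + 1 := by
  classical
  have hind : LinearIndepOn F (id : V → V) {p} := LinearIndepOn.singleton hp
  -- Extend `p` to a basis `b` of the span. The functional kills `b \ {p}`, which has one element
  -- fewer than the rank.
  obtain ⟨b, hbt, hpb, htb, hb⟩ := exists_linearIndepOn_extension hind
    (show {p} ⊆ g '' B ∪ {p} from Set.subset_union_right)
  simp only [Set.image_id] at htb
  have hpb' : p ∈ b := hpb rfl
  have hnot : p ∉ Submodule.span F (b \ {p}) := by
    rw [(LinearIndepOn.mono hb Set.sdiff_subset).notMem_span_iff_id]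
    refine ⟨?_, by simp⟩
    rwa [Set.insert_sdiff_singleton, Set.insert_eq_of_mem hpb']
  obtain ⟨l, hl, hker⟩ := Submodule.exists_le_ker_of_notMem hnot
  refine ⟨l, hl, B.filter fun n => l (g n) = 0, filter_subset _ _, by simp, ?_⟩
  have hfin : b.Finite := ((B.finite_toSet.image g).union (Set.finite_singleton p)).subset hbt
  have hsub : b ⊆ ↑(insert p ((B.filter fun n => l (g n) = 0).image g)) := by
    intro x hx
    by_cases hxp : x = p
    · simp [hxp]
    have hlx : l x = 0 := hker (Submodule.subset_span ⟨hx, hxp⟩)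
    rcases hbt hx with ⟨n, hn, rfl⟩ | h
    · simp only [coe_insert, coe_image, Set.mem_insert_iff, Set.mem_image, mem_coe, mem_filter]
      exact Or.inr ⟨n, ⟨hn, hlx⟩, rfl⟩
    · exact absurd h hxp
  have hle : Submodule.span F (g '' B) ⊔ Submodule.span F {p} ≤
      Submodule.span F (↑(insert p ((B.filter fun n => l (g n) = 0).image g)) : Set V) := by
    rw [← Submodule.span_union, Submodule.span_le]
    exact fun x hx => Submodule.span_mono hsub (htb hx)
  calc _ ≤ _ := Submodule.finrank_mono hle
    _ ≤ _ := finrank_span_finset_le_card _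
    _ ≤ _ := card_insert_le _ _
    _ ≤ _ := Nat.add_le_add_right card_image_le 1

/-- The rank modulo `p` is monotone and submodular. Were there no such `X`, Rado's argument, started
from `d` copies of `E`, would give disjoint parts, and one hyperplane per part would cover all but
at most `s - 1` members. -/
theorem exists_subset_rank_lt [FiniteDimensional F V] {d s : ℕ} {E : Finset η} {g : η → V} {p : V}
    (hp : p ≠ 0) (hs : 1 ≤ s) (h : Uncoverable (F := F) d s E g p) :
    ∃ X ⊆ E, d * finrank F ↥(Submodule.span F (g '' X) ⊔ Submodule.span F {p}) + s ≤
      X.card + d := by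
  classical
  by_contra! hcon
  obtain ⟨R, hR⟩ : ∃ R : Finset η → Submodule F V,
    ∀ X, R X = Submodule.span F (g '' X) ⊔ Submodule.span F {p} := ⟨_, fun _ => rfl⟩
  replace hcon : ∀ X ⊆ E, X.card + d < d * finrank F (R X) + s := fun X hX => by
    rw [hR]; exact hcon X hX
  have hRmono : Monotone R := fun X Y hXY => by
    rw [hR, hR]
    exact sup_le_sup_right (Submodule.span_mono (Set.image_mono (by exact_mod_cast hXY))) _
  have hRpos : ∀ X, 1 ≤ finrank F (R X) := by
    intro X
    have : finrank F (Submodule.span F {p}) ≤ finrank F (R X) :=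
      Submodule.finrank_mono (hR X ▸ le_sup_right)
    rwa [finrank_span_singleton hp] at this
  have hRsub : ∀ X Y, finrank F (R (X ∪ Y)) + finrank F (R (X ∩ Y)) ≤
      finrank F (R X) + finrank F (R Y) := by
    intro X Y
    rw [← Submodule.finrank_sup_add_finrank_inf_eq (R X) (R Y)]
    have hU : R (X ∪ Y) = R X ⊔ R Y := by
      rw [hR, hR, hR, coe_union, Set.image_union, Submodule.span_union, sup_sup_distrib_right]
    rw [hU]
    exact Nat.add_le_add_left (Submodule.finrank_mono
      (le_inf (hRmono inter_subset_left) (hRmono inter_subset_right))) _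
  obtain ⟨B, hBE, hdis, hcard⟩ := exists_pairwiseDisjoint_card_le_sum (τ := Fin d)
    (fun X => finrank F (R X) - 1)
    (fun X Y hXY => Nat.sub_le_sub_right (Submodule.finrank_mono (hRmono hXY)) 1)
    (fun X Y => by
      have := hRsub X Y
      have := hRpos X; have := hRpos Y; have := hRpos (X ∪ Y); have := hRpos (X ∩ Y)
      omega) E (s - 1) (fun _ => E) (fun X hX => by
      have h1 := hcon X hX
      rw [inter_eq_left.mpr hX]
      simp only [sum_const, card_univ, Fintype.card_fin, smul_eq_mul, Nat.mul_sub, mul_one]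
      have h2 : d * 1 ≤ d * finrank F (R X) := Nat.mul_le_mul_left d (hRpos X)
      omega)
  choose l hlp I hIB hI0 hIcard using fun i => exists_dual_card_zeros (F := F) g hp (B i)
  have hun := h l hlp
  have hIdis : ((univ : Finset (Fin d)) : Set (Fin d)).PairwiseDisjoint I :=
    fun i _ j _ hij => (hdis hij).mono (hIB i) (hIB j)
  have hsub : univ.biUnion I ⊆ E := biUnion_subset.mpr fun i _ => (hIB i).trans (hBE i)
  have hfil : (E.filter fun n => ∀ i, l i (g n) ≠ 0) ⊆ E \ univ.biUnion I := by
    intro n hn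
    simp only [mem_filter, mem_sdiff, mem_biUnion, mem_univ, true_and, not_exists] at hn ⊢
    exact ⟨hn.1, fun i hi => hn.2 i (hI0 i n hi)⟩
  have h1 := hun.trans (card_le_card hfil)
  have h2 := card_sdiff_add_card_eq_card hsub
  rw [card_biUnion hIdis] at h2
  have h3 : ∑ i, (finrank F (R (B i)) - 1) ≤ ∑ i, (I i).card := by
    gcongr with i
    have := hIcard i
    rw [← hR] at this
    omega
  omega

theorem finrank_map_mkQ_add [FiniteDimensional F V] {W Y : Submodule F V} :
    finrank F (Y.map W.mkQ) + finrank F ↥(W ⊓ Y) = finrank F Y := by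
  have := (W.mkQ.domRestrict Y).finrank_range_add_finrank_ker
  rw [LinearMap.range_domRestrict, LinearMap.ker_domRestrict, Submodule.ker_mkQ] at this
  rw [← this]
  congr 1
  rw [inf_comm, ← Submodule.map_comap_subtype]
  exact LinearEquiv.finrank_eq (Submodule.equivMapOfInjective _ Y.injective_subtype _).symm

theorem span_image_mkQ {W : Submodule F V} (g : η → V) (X : Set η) :
    Submodule.span F ((fun n => W.mkQ (g n)) '' X) = (Submodule.span F (g '' X)).map W.mkQ := by
  rw [Submodule.map_span, Set.image_image]

/-- If the span `Y` of the subfamily just found misses `p`, adding `p` raises its rank by one, so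
the subfamily has `d * finrank F Y + s` members. The members outside `Y` stay uncoverable modulo
`Y`, and induction on the dimension supplies the rest. -/
theorem exists_subset_mem_span {n d s : ℕ} (hd : 0 < d) (hs : 1 ≤ s) :
    ∀ {V : Type*} [AddCommGroup V] [Module F V] [FiniteDimensional F V] {E : Finset η}
      {g : η → V} {p : V}, finrank F V = n → p ≠ 0 → Uncoverable (F := F) d s E g p →
    ∃ X ⊆ E, p ∈ Submodule.span F (g '' X) ∧
      d * finrank F (Submodule.span F (g '' X)) + s ≤ X.card + d := by
  classical
  induction n using Nat.strong_induction_on with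
  | _ n ih =>
  intro V _ _ _ E g p hn hp h
  -- Without zero vectors, `Y` is nonzero and the quotient has smaller dimension.
  have h0 : Uncoverable (F := F) d s (E.filter fun n => g n ≠ 0) g p :=
    h.mono_set fun n hn l hl => mem_filter.mpr ⟨hn, fun h0 => hl ⟨0, hd⟩ (by simp [h0])⟩
  obtain ⟨X, hXE, hX⟩ := exists_subset_rank_lt hp hs h0
  set Y := Submodule.span F (g '' X) with hY
  by_cases hpY : p ∈ Y
  · refine ⟨X, hXE.trans (filter_subset _ _), hpY, ?_⟩
    rwa [sup_eq_left.mpr ((Submodule.span_singleton_le_iff_mem _ _).mpr hpY)] at hX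
  have hlt : finrank F Y + 1 ≤ finrank F ↥(Y ⊔ Submodule.span F {p}) := by
    refine Submodule.finrank_lt_finrank_of_lt (lt_of_le_of_ne le_sup_left fun heq => hpY ?_)
    rw [heq]
    exact (le_sup_right : _ ≤ Y ⊔ Submodule.span F {p}) (Submodule.mem_span_singleton_self p)
  have hX' : d * finrank F Y + s ≤ X.card := by
    have := Nat.mul_le_mul_left d hlt
    rw [mul_add, mul_one] at this
    omega
  have hXne : X.Nonempty := card_pos.mp (by omega)
  obtain ⟨m, hm⟩ := hXne
  have hgm : g m ∈ Y := Submodule.subset_span ⟨m, hm, rfl⟩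
  have hYpos : 0 < finrank F Y := by
    rw [Module.finrank_pos_iff, Submodule.nontrivial_iff_ne_bot]
    exact fun hbot => (mem_filter.mp (hXE hm)).2 (by simpa [hbot] using hgm)
  have hq := Y.finrank_quotient_add_finrank
  have hunc : Uncoverable (F := F) d s (E.filter fun n => g n ∉ Y) (fun n => Y.mkQ (g n))
      (Y.mkQ p) := (h.map Y.mkQ).mono_set fun n hn l hl => mem_filter.mpr ⟨hn, fun hnY =>
        hl ⟨0, hd⟩ (by simp [(Submodule.Quotient.mk_eq_zero Y).mpr hnY])⟩
  obtain ⟨X', hXE', hpX', hX''⟩ := ih (finrank F (V ⧸ Y)) (by omega) rfl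
    (by simpa using hpY) hunc
  rw [span_image_mkQ] at hpX' hX''
  have hspan : Submodule.span F (g '' ↑(X ∪ X')) = Y ⊔ Submodule.span F (g '' X') := by
    rw [coe_union, Set.image_union, Submodule.span_union]
  refine ⟨X ∪ X', union_subset (hXE.trans (filter_subset _ _))
    (hXE'.trans (filter_subset _ _)), ?_, ?_⟩
  · rw [hspan]
    have := Submodule.comap_map_mkQ Y (Submodule.span F (g '' X'))
    rw [← this]
    exact hpX'
  · have hdisj : Disjoint X X' := by
      rw [Finset.disjoint_left]
      exact fun n hn hn' => (mem_filter.mp (hXE' hn')).2 (Submodule.subset_span ⟨n, hn, rfl⟩)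
    rw [hspan, card_union_of_disjoint hdisj]
    have h1 := finrank_map_mkQ_add (F := F) (W := Y) (Y := Y ⊔ Submodule.span F (g '' X'))
    rw [Submodule.map_sup, Submodule.mkQ_map_self, bot_sup_eq, inf_eq_left.mpr le_sup_left] at h1
    rw [← h1, mul_add]
    omega

/-- A family that remains uncoverable at the members of a spanning family is large. -/
theorem card_ge_of_uncoverable_span {θ : Type*} {n d s : ℕ} (hd : 0 < d) (hs : d ≤ s)
    (hn : 0 < n) :
    ∀ {V : Type*} [AddCommGroup V] [Module F V] [FiniteDimensional F V] {E : Finset η}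
      {g : η → V} {e : θ → V}, finrank F V = n → Submodule.span F (Set.range e) = ⊤ →
      (∀ j, Uncoverable (F := F) d s E g (e j)) → d * n + s ≤ E.card + d := by
  classical
  induction n using Nat.strong_induction_on with
  | _ n ih =>
  intro V _ _ _ E g e hV he h
  obtain ⟨j, hj⟩ : ∃ j, e j ≠ 0 := by
    by_contra! h0
    have : Submodule.span F (Set.range e) = ⊥ := by
      rw [Submodule.span_eq_bot]; rintro _ ⟨j, rfl⟩; exact h0 j
    rw [this] at he
    have := finrank_top F V
    rw [← he, finrank_bot] at this
    omega
  obtain ⟨X, hXE, hjX, hX⟩ := exists_subset_mem_span hd (by omega : 1 ≤ s) rfl hj (h j)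
  set Y := Submodule.span F (g '' X) with hY
  have hYpos : 0 < finrank F Y := by
    rw [Module.finrank_pos_iff, Submodule.nontrivial_iff_ne_bot]
    exact fun hbot => hj (by simpa [hbot] using hjX)
  have hq := Y.finrank_quotient_add_finrank
  rcases Nat.eq_zero_or_pos (finrank F (V ⧸ Y)) with h0 | hpos
  · have : finrank F Y = n := by omega
    rw [this] at hX
    have := card_le_card hXE
    omega
  have hunc : ∀ j, Uncoverable (F := F) d s (E.filter fun n => g n ∉ Y)
      (fun n => Y.mkQ (g n)) (Y.mkQ (e j)) := fun j =>
    ((h j).map Y.mkQ).mono_set fun n hn l hl => mem_filter.mpr ⟨hn, fun hnY =>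
      hl ⟨0, hd⟩ (by simp [(Submodule.Quotient.mk_eq_zero Y).mpr hnY])⟩
  have hspan : Submodule.span F (Set.range fun j => Y.mkQ (e j)) = ⊤ := by
    rw [← Set.image_univ, span_image_mkQ, Set.image_univ, he, Submodule.map_top,
      Submodule.range_mkQ]
  have h1 := ih (finrank F (V ⧸ Y)) (by omega) hpos rfl hspan hunc
  have hdisj : Disjoint X (E.filter fun n => g n ∉ Y) := by
    rw [Finset.disjoint_left]
    exact fun n hn hn' => (mem_filter.mp hn').2 (Submodule.subset_span ⟨n, hn, rfl⟩)
  -- Adding the two counts leaves a surplus `s - d`, which is nonnegative by `hs`.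
  have h2 := card_le_card (union_subset hXE (filter_subset (fun n => g n ∉ Y) E))
  rw [card_union_of_disjoint hdisj] at h2
  rw [← hV, ← hq, mul_add]
  omega

/-- If small subfamilies span subspaces that are independent of `P`, the span of any subfamily that
meets `P` exceeds its intersection with `P` by at least `L` dimensions. -/
theorem finrank_inf_add_le [FiniteDimensional F V] {L : ℕ} {E X : Finset η} {g : η → V}
    {P : Submodule F V} (hpriv : ∀ A ⊆ E, A.card ≤ L → Disjoint (Submodule.span F (g '' A)) P)
    (hX : X ⊆ E) {p : V} (hp : p ≠ 0) (hpP : p ∈ P) (hpX : p ∈ Submodule.span F (g '' X)) :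
    finrank F ↥(Submodule.span F (g '' X) ⊓ P) + L ≤ finrank F (Submodule.span F (g '' X)) := by
  classical
  obtain ⟨b, hbX, -, hXb, hb⟩ := exists_linearIndepOn_extension
    (linearIndepOn_empty F g) (Set.empty_subset (X : Set η))
  have hspan : Submodule.span F (g '' b) = Submodule.span F (g '' X) :=
    le_antisymm (Submodule.span_mono (Set.image_mono hbX)) (Submodule.span_le.mpr hXb)
  lift b to Finset η using X.finite_toSet.subset hbX
  have hbE : b ⊆ E := (by exact_mod_cast hbX : b ⊆ X).trans hX
  by_cases hbL : b.card ≤ L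
  · refine absurd ?_ hp
    have := hpriv b hbE hbL
    rw [hspan] at this
    simpa using this.le_bot ⟨hpX, hpP⟩
  obtain ⟨A, hAb, hA⟩ := exists_subset_card_eq (not_le.mp hbL).le
  have hdis := hpriv A (hAb.trans hbE) hA.le
  have hAX : Submodule.span F (g '' A) ≤ Submodule.span F (g '' X) := by
    rw [← hspan]; exact Submodule.span_mono (Set.image_mono (by exact_mod_cast hAb))
  have hAr : finrank F (Submodule.span F (g '' A)) = L := by
    have hA' : LinearIndepOn F g (A : Set η) := LinearIndepOn.mono hb (by exact_mod_cast hAb)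
    have := finrank_span_eq_card (R := F) hA'
    rw [Set.image_eq_range, ← hA]
    exact this.trans (Fintype.card_coe A)
  have h1 := Submodule.finrank_sup_add_finrank_inf_eq (Submodule.span F (g '' A))
    (Submodule.span F (g '' X) ⊓ P)
  have h2 : Submodule.span F (g '' A) ⊓ (Submodule.span F (g '' X) ⊓ P) = ⊥ :=
    (hdis.mono_right inf_le_right).eq_bot
  rw [h2, finrank_bot, hAr] at h1
  have h3 := Submodule.finrank_mono (sup_le hAX
    (inf_le_left : Submodule.span F (g '' X) ⊓ P ≤ Submodule.span F (g '' X)))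
  omega

/-- A family that remains uncoverable at the vectors `e j`, small parts of which are independent of
the span of the `e j`, is large. -/
theorem card_ge_of_uncoverable_private {θ : Type*} {n d L : ℕ} (hd : 0 < d) (hL : 0 < L) :
    ∀ {V : Type*} [AddCommGroup V] [Module F V] [FiniteDimensional F V] {E : Finset η}
      {g : η → V} {e : θ → V} {φ : Dual F V}, finrank F V = n →
      (∃ j, e j ≠ 0) → (∀ j, φ (e j) = 0) → (∀ m ∈ E, φ (g m) ≠ 0) →
      (∀ A ⊆ E, A.card ≤ L →
        Disjoint (Submodule.span F (g '' A)) (Submodule.span F (Set.range e))) →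
      (∀ j, Uncoverable (F := F) d 1 E g (e j)) →
      d * (finrank F (Submodule.span F (Set.range e)) + L) + 1 ≤ E.card + d := by
  classical
  induction n using Nat.strong_induction_on generalizing L with
  | _ n ih =>
  intro V _ _ _ E g e φ hV ⟨j, hj⟩ hφe hφg hpriv h
  obtain ⟨X, hXE, hjX, hX⟩ := exists_subset_mem_span hd le_rfl rfl hj (h j)
  set P := Submodule.span F (Set.range e) with hP
  have hjP : e j ∈ P := Submodule.subset_span ⟨j, rfl⟩
  have hdim := finrank_inf_add_le hpriv hXE hj hjP hjX
  set Y := Submodule.span F (g '' X) with hY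
  have hPφ : P ≤ φ.ker := Submodule.span_le.mpr (by rintro _ ⟨j, rfl⟩; exact hφe j)
  by_cases hPY : P ≤ Y
  · rw [inf_eq_right.mpr hPY] at hdim
    have := Nat.mul_le_mul_left d hdim
    have := card_le_card hXE
    omega
  obtain ⟨n₀, hn₀⟩ : X.Nonempty := by
    rw [nonempty_iff_ne_empty]; rintro rfl; exact hj (by simpa [hY] using hjX)
  -- Dividing by all of `Y` would lose too much. Modulo `W`, `Y` becomes a line not killed by `φ`,
  -- so the single member `n₀` can stand for all members in `Y`.
  set W := Y ⊓ φ.ker with hW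
  have hjW : e j ∈ W := ⟨hjX, hPφ hjP⟩
  have hWpos : 0 < finrank F W := by
    rw [Module.finrank_pos_iff, Submodule.nontrivial_iff_ne_bot]
    exact fun hbot => hj (by simpa [hbot] using hjW)
  have hq := W.finrank_quotient_add_finrank
  have hWφ : W ≤ φ.ker := inf_le_right
  have hg₀Y : g n₀ ∈ Y := Submodule.subset_span ⟨n₀, hn₀, rfl⟩
  have hg₀ : φ (g n₀) ≠ 0 := hφg _ (hXE hn₀)
  set E' := insert n₀ (E.filter fun n => g n ∉ Y) with hE'
  have hE'E : E' ⊆ E := insert_subset (hXE hn₀) (filter_subset _ _)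
  have hspanP : Submodule.span F (Set.range fun j => W.mkQ (e j)) = P.map W.mkQ := by
    rw [← Set.image_univ, span_image_mkQ, Set.image_univ]
  have hφ' : ∀ x, (W.liftQ φ hWφ) (W.mkQ x) = φ x := fun x => by simp
  have hunc : ∀ j, Uncoverable (F := F) d 1 E' (fun n => W.mkQ (g n)) (W.mkQ (e j)) := by
    intro j l hl
    have := h j (fun i => (l i).comp W.mkQ) hl
    rw [Nat.one_le_iff_ne_zero, Nat.ne_zero_iff_zero_lt, card_pos] at this ⊢
    obtain ⟨m, hm⟩ := this
    rw [mem_filter] at hm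
    by_cases hmY : g m ∈ Y
    · refine ⟨n₀, mem_filter.mpr ⟨mem_insert_self _ _, fun i hi => hm.2 i ?_⟩⟩
      have hmW : g m - (φ (g m) / φ (g n₀)) • g n₀ ∈ W := by
        refine ⟨Y.sub_mem hmY (Y.smul_mem _ hg₀Y), ?_⟩
        simp [LinearMap.mem_ker, div_mul_cancel₀ _ hg₀]
      have h0 : W.mkQ (g m) = (φ (g m) / φ (g n₀)) • W.mkQ (g n₀) := by
        rw [← sub_eq_zero, ← map_smul, ← map_sub]
        exact (Submodule.Quotient.mk_eq_zero W).mpr hmW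
      simp only [LinearMap.comp_apply]
      rw [h0, map_smul, hi, smul_zero]
    · exact ⟨m, mem_filter.mpr ⟨mem_insert_of_mem (mem_filter.mpr ⟨hm.1, hmY⟩), hm.2⟩⟩
  have hne : ∃ j, W.mkQ (e j) ≠ 0 := by
    by_contra! h0
    refine hPY (Submodule.span_le.mpr ?_)
    rintro _ ⟨j, rfl⟩
    exact ((Submodule.Quotient.mk_eq_zero W).mp (h0 j)).1
  -- Only privacy for single members survives, thanks to `φ`. This suffices: the induction at `L =
  -- 1` gains `d`, which offsets the `d` lost by splitting, and the full `L` is paid once, by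
  -- `hdim`.
  have hpriv' : ∀ A ⊆ E', A.card ≤ 1 → Disjoint
      (Submodule.span F ((fun n => W.mkQ (g n)) '' A))
      (Submodule.span F (Set.range fun j => W.mkQ (e j))) := by
    intro A hA hA1
    rw [Submodule.disjoint_def]
    intro x hx hxP
    have hx0 : (W.liftQ φ hWφ) x = 0 := by
      rw [hspanP] at hxP
      obtain ⟨y, hy, rfl⟩ := hxP
      rw [hφ']; exact hPφ hy
    rcases A.eq_empty_or_nonempty with rfl | ⟨m, hm⟩
    · simpa using hx
    have hAm : A = {m} := eq_singleton_iff_unique_mem.mpr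
      ⟨hm, fun k hk => card_le_one.mp hA1 k hk m hm⟩
    rw [hAm, coe_singleton, Set.image_singleton, Submodule.mem_span_singleton] at hx
    obtain ⟨c, rfl⟩ := hx
    rw [map_smul, hφ', smul_eq_mul, mul_eq_zero] at hx0
    rw [hx0.resolve_right (hφg m (hE'E (hA hm))), zero_smul]
  have h1 := ih (finrank F (V ⧸ W)) (by omega) one_pos (e := fun j => W.mkQ (e j))
    (φ := W.liftQ φ hWφ) rfl hne (fun j => by rw [hφ', hφe])
    (fun m hm => by rw [hφ']; exact hφg m (hE'E hm)) hpriv' hunc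
  rw [hspanP] at h1
  have h2 := finrank_map_mkQ_add (F := F) (W := W) (Y := P)
  have h3 : W ⊓ P = Y ⊓ P := by rw [hW, inf_assoc, inf_eq_right.mpr hPφ]
  rw [h3] at h2
  have hdisj : Disjoint X (E.filter fun n => g n ∉ Y) := by
    rw [Finset.disjoint_left]
    exact fun n hn hn' => (mem_filter.mp hn').2 (Submodule.subset_span ⟨n, hn, rfl⟩)
  have h4 := card_le_card (union_subset hXE (filter_subset (fun n => g n ∉ Y) E))
  rw [card_union_of_disjoint hdisj] at h4
  have h5 : E'.card ≤ (E.filter fun n => g n ∉ Y).card + 1 := card_insert_le _ _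
  have h6 : d * (finrank F P + L) ≤ d * finrank F (P.map W.mkQ) + d * finrank F Y := by
    rw [← mul_add]; exact Nat.mul_le_mul_left d (by omega)
  rw [mul_add, mul_one] at h1
  omega

end Covering

/-! ### Iterated finite differences of polynomials. -/

section MixedDifference

/-- The iterated finite difference with increments `l`. -/
def mixedDiff {A M : Type*} [Add A] [Sub M] : List A → (A → M) → A → M
  | [], q, x => q x
  | h :: l, q, x => mixedDiff l q (x + h) - mixedDiff l q x

theorem mixedDiff_comp {A A' M : Type*} [Add A] [Add A'] [Sub M] (φ : A →ₙ+ A') (q : A' → M)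
    (l : List A) (x : A) : mixedDiff l (fun y => q (φ y)) x = mixedDiff (l.map φ) q (φ x) := by
  induction l generalizing x with
  | nil => rfl
  | cons h l ih => simp only [mixedDiff, List.map_cons, ih, map_add]

theorem map_mixedDiff {A M M' : Type*} [Add A] [AddGroup M] [AddGroup M'] (φ : M →+ M')
    (q : A → M) (l : List A) (x : A) : φ (mixedDiff l q x) = mixedDiff l (fun y => φ (q y)) x := by
  induction l generalizing x with
  | nil => rfl
  | cons h l ih => simp only [mixedDiff, map_sub, ih]

/-- Difference operators commute, so the first increment may act innermost, on the polynomial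
itself. -/
theorem mixedDiff_cons {A M : Type*} [AddCommSemigroup A] [AddCommGroup M] (q : A → M)
    (h : A) (l : List A) (x : A) :
    mixedDiff (h :: l) q x = mixedDiff l (fun y => q (y + h) - q y) x := by
  induction l generalizing x with
  | nil => rfl
  | cons h' l ih =>
    have e := ih x
    have e' := ih (x + h')
    simp only [mixedDiff] at e e' ⊢
    rw [← e, ← e', add_right_comm x h' h]
    abel

-- A difference with increment `h` lowers the degree bound from `m + 1` to `m` and multiplies the
-- top coefficient by `(m + 1) * h`.
open Polynomial in
theorem mixedDiff_eval {F : Type*} [Field F] (l : List F) (q : F[X])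
    (hq : q.natDegree ≤ l.length) (x : F) :
    mixedDiff l (fun y => q.eval y) x = l.length.factorial * q.coeff l.length * l.prod := by
  induction l generalizing q with
  | nil =>
    rw [List.length_nil, Nat.le_zero] at hq
    simp only [mixedDiff]
    rw [eq_C_of_natDegree_eq_zero hq]
    simp
  | cons h l ih =>
    set m := l.length with hm
    rw [List.length_cons, ← hm] at hq
    have hcoeff : ∀ n, m ≤ n →
        (taylor h q).coeff n = q.coeff n + (n + 1) * q.coeff (n + 1) * h := by
      intro n hn
      rw [taylor_coeff, eval_eq_sum_range' (n := 2)
        (by have := natDegree_hasseDeriv_le q n; omega)]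
      simp [Finset.sum_range_succ, hasseDeriv_coeff, add_comm 1 n]
    have hdeg : (taylor h q - q).natDegree ≤ m := by
      rw [natDegree_le_iff_coeff_eq_zero]
      intro n hn
      rw [coeff_sub, hcoeff n hn.le, coeff_eq_zero_of_natDegree_lt (n := n + 1) (by omega)]
      simp
    have := ih (taylor h q - q) hdeg
    rw [mixedDiff_cons]
    simp only [eval_sub, taylor_eval] at this
    simp only [List.length_cons, List.prod_cons, Nat.factorial_succ]
    rw [this, coeff_sub, hcoeff m le_rfl]
    push_cast
    ring

end MixedDifference

/-! ### From linear decodability to uncoverability. -/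

section Decoding

open Polynomial

variable {F : Type*} [Field F] {ι κ : Type*} {N K : ℕ}

/-- The restriction of a multivariate polynomial to the line through `w`. -/
def alongLine (w : ι → F) (p : MvPolynomial ι F) : F[X] :=
  MvPolynomial.aeval (fun j => C (w j) * X) p

theorem eval_alongLine (w : ι → F) (p : MvPolynomial ι F) (x : F) :
    (alongLine w p).eval x = MvPolynomial.eval (x • w) p := by
  rw [alongLine, ← coe_evalRingHom, MvPolynomial.map_aeval, MvPolynomial.eval]
  congr 1
  · ext j
    · simp
    · rw [MvPolynomial.eval₂Hom_X', MvPolynomial.eval₂Hom_X', coe_evalRingHom, eval_C_mul, eval_X,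
        Pi.smul_apply, smul_eq_mul, mul_comm]

theorem natDegree_alongLine_le (w : ι → F) (p : MvPolynomial ι F) :
    (alongLine w p).natDegree ≤ p.totalDegree := by
  have := MvPolynomial.aeval_natDegree_le (m := p.totalDegree) (n := 1) p le_rfl
    (fun j => C (w j) * X) (fun j => (natDegree_C_mul_le _ _).trans natDegree_X_le)
  rwa [mul_one] at this

theorem coeff_alongLine (w : ι → F) (p : MvPolynomial ι F) (n : ℕ) :
    (alongLine w p).coeff n = MvPolynomial.eval w (MvPolynomial.homogeneousComponent n p) := by
  induction p using MvPolynomial.induction_on' with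
  | monomial m c =>
    have h1 : alongLine w (MvPolynomial.monomial m c) =
        C (c * m.prod fun j e => w j ^ e) * X ^ m.degree := by
      rw [alongLine, MvPolynomial.aeval_monomial, ← C_eq_algebraMap, C_mul, mul_assoc]
      congr 1
      simp only [Finsupp.prod, mul_pow, Finset.prod_mul_distrib, Finset.prod_pow_eq_pow_sum,
        map_prod, map_pow]
      rfl
    rw [h1, coeff_C_mul_X_pow, MvPolynomial.homogeneousComponent_of_mem
      (MvPolynomial.isHomogeneous_monomial c rfl : (MvPolynomial.monomial m c).IsHomogeneous _)]
    split_ifs with h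
    · rw [MvPolynomial.eval_monomial]
    · rw [map_zero]
  | add p q hp hq =>
    rw [map_add, map_add, ← hp, ← hq, alongLine, map_add, coeff_add]
    rfl

/-- The coefficient is the value at `w` of the homogeneous part of degree `d`. That part is nonzero
and has degree at most `d` in each variable, so it cannot vanish on the grid of the `d + 1` elements
`0, …, d`, distinct by `hchar`. -/
theorem exists_coeff_alongLine_ne_zero [Finite ι] {p : MvPolynomial ι F} {d : ℕ} (hd : 1 ≤ d)
    (hp : p.totalDegree = d) (hchar : ∀ j : ℕ, 1 ≤ j → j ≤ d → (j : F) ≠ 0) :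
    ∃ w : ι → F, (alongLine w p).coeff d ≠ 0 := by
  classical
  by_contra! h0
  simp only [coeff_alongLine] at h0
  have hinj : Set.InjOn (fun j : ℕ => (j : F)) (Finset.range (d + 1)) := by
    have key : ∀ a b : ℕ, a < b → b ≤ d → (a : F) ≠ b := by
      intro a b hab hb h
      refine hchar (b - a) (by omega) (by omega) ?_
      rw [Nat.cast_sub hab.le, h, sub_self]
    intro a ha b hb hab
    simp only [Finset.coe_range, Set.mem_Iio] at ha hb
    rcases lt_trichotomy a b with h | h | h
    · exact absurd hab (key a b h (by omega))
    · exact h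
    · exact absurd hab.symm (key b a h (by omega))
  have hz : MvPolynomial.homogeneousComponent d p = 0 := by
    refine MvPolynomial.eq_zero_of_eval_zero_at_prod_finset _
      (fun _ => (Finset.range (d + 1)).image fun j : ℕ => (j : F)) (fun i => ?_)
      (fun x _ => h0 x)
    rw [Finset.card_image_of_injOn hinj, Finset.card_range, Nat.lt_succ_iff]
    exact (MvPolynomial.degreeOf_le_totalDegree _ _).trans
      (MvPolynomial.homogeneousComponent_isHomogeneous d p).totalDegree_le
  obtain ⟨m, hm, hmd⟩ : ∃ m ∈ p.support, (m.sum fun _ e => e) = d := by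
    have hne : p.support.Nonempty := by
      rw [Finset.nonempty_iff_ne_empty, Ne, MvPolynomial.support_eq_empty]
      rintro rfl
      simp at hp; omega
    obtain ⟨m, hm, h⟩ := Finset.exists_mem_eq_sup p.support hne fun s => s.sum fun _ e => e
    exact ⟨m, hm, by rw [← h]; exact hp⟩
  have := congrArg (MvPolynomial.coeff m) hz
  rw [MvPolynomial.coeff_homogeneousComponent, MvPolynomial.coeff_zero,
    if_pos (by rw [← hmd]; rfl)] at this
  exact MvPolynomial.mem_support_iff.mp hm this

namespace LinearScheme

/-- The encoding vector of worker `n`: its coefficients at the data blocks and the random blocks. -/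
def row (s : LinearScheme F N K) (n : Fin N) : Fin K ⊕ Fin s.keys → F :=
  Sum.elim (s.G n) (s.H n)

/-- The encoding vector of the uncoded data block `k`. -/
def unitRow (s : LinearScheme F N K) (k : Fin K) : Fin K ⊕ Fin s.keys → F :=
  Pi.single (Sum.inl k) 1

theorem encode_smul (s : LinearScheme F N K) (w : ι → F)
    (ξ : Module.Dual F (Fin K ⊕ Fin s.keys → F)) (n : Fin N) :
    s.encode (fun k => ξ (Pi.single (Sum.inl k) 1) • w)
      (fun t => ξ (Pi.single (Sum.inr t) 1) • w) n = ξ (s.row n) • w := by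
  classical
  have h : ξ (s.row n) = ∑ j, s.row n j * ξ (Pi.single j 1) := by
    rw [LinearMap.pi_apply_eq_sum_univ ξ (s.row n)]
    refine Finset.sum_congr rfl fun j _ => ?_
    rw [smul_eq_mul]
    congr 2
    funext i
    simp [Pi.single_apply, eq_comm]
  rw [h, Fintype.sum_sum_type, add_smul, Finset.sum_smul, Finset.sum_smul]
  simp only [encode, row, Sum.elim_inl, Sum.elim_inr, smul_smul]

/-- Linear decoding of a polynomial of degree `d` from any `N - S` results: any `c ≤ d` functionals
that do not vanish at the encoding vector of a data block are nonzero at more than `S` common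
encoding vectors of the workers. -/
theorem uncoverable_of_recoversWith [Finite ι] [Fintype κ] {s : LinearScheme F N K}
    {f : κ → MvPolynomial ι F} {S d c : ℕ} (hd : 1 ≤ d) (hdeg : polyDegree f = d) (hS : S ≤ N)
    (hchar : ∀ j : ℕ, 1 ≤ j → j ≤ d → (j : F) ≠ 0) {dec : Decoder F κ N K}
    (h : s.RecoversWith f S dec) (hc : 0 < c) (hcd : c ≤ d) (k : Fin K) :
    Uncoverable (F := F) c (S + 1) Finset.univ s.row (s.unitRow k) := by
  classical
  intro l hl
  by_contra! hlt
  set bad := Finset.univ.filter fun n => ∀ i, l i (s.row n) ≠ 0 with hbad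
  obtain ⟨R, hRbad, hR⟩ : ∃ R ⊆ badᶜ, R.card = N - S := by
    refine Finset.exists_subset_card_eq ?_
    rw [Finset.card_compl, Fintype.card_fin]
    omega
  obtain ⟨i₀, hi₀⟩ : ∃ i₀, (f i₀).totalDegree = d := by
    have hne : (Finset.univ : Finset κ).Nonempty := by
      rw [Finset.nonempty_iff_ne_empty]
      intro h0
      rw [polyDegree, h0, Finset.sup_empty] at hdeg
      simp at hdeg; omega
    obtain ⟨i, -, hi⟩ := Finset.exists_mem_eq_sup _ hne fun i => (f i).totalDegree
    exact ⟨i, by rw [← hi]; exact hdeg⟩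
  obtain ⟨w, hw⟩ := exists_coeff_alongLine_ne_zero hd hi₀ hchar
  -- Repeating the last functional brings the order of the difference up to exactly `d` and adds no
  -- new zeros.
  set pad : List (Module.Dual F (Fin K ⊕ Fin s.keys → F)) :=
    List.ofFn fun i : Fin d => l ⟨min i (c - 1), by omega⟩ with hpad
  have hlen : pad.length = d := by simp [hpad]
  have hdiff : ∀ (v : Fin K ⊕ Fin s.keys → F) (i : κ),
      mixedDiff pad (fun ξ => (alongLine w (f i)).eval (ξ v)) 0 =
        d.factorial * (alongLine w (f i)).coeff d * (pad.map fun ξ => ξ v).prod := by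
    intro v i
    have hi : (alongLine w (f i)).natDegree ≤ d := by
      refine (natDegree_alongLine_le _ _).trans (hdeg ▸ ?_)
      exact Finset.le_sup (f := fun i => (f i).totalDegree) (Finset.mem_univ i)
    let φ : Module.Dual F (Fin K ⊕ Fin s.keys → F) →ₙ+ F := ⟨fun ξ => ξ v, fun _ _ => rfl⟩
    have h1 := mixedDiff_comp φ (fun y => (alongLine w (f i)).eval y) pad 0
    rw [mixedDiff_eval _ _ (by rwa [List.length_map, hlen]), List.length_map, hlen] at h1
    exact h1
  let Q : Module.Dual F (Fin K ⊕ Fin s.keys → F) → (R → κ → F) :=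
    fun ξ n i => (alongLine w (f i)).eval (ξ (s.row n))
  have hQ : mixedDiff pad Q 0 = 0 := by
    funext n i
    have h1 := map_mixedDiff ((Pi.evalAddMonoidHom _ i).comp
      (Pi.evalAddMonoidHom (fun _ : R => κ → F) n)) Q pad 0
    refine h1.trans ((hdiff (s.row n) i).trans ?_)
    have hn := hRbad n.2
    simp only [hbad, Finset.mem_compl, Finset.mem_filter, Finset.mem_univ, true_and, not_forall,
      not_not] at hn
    obtain ⟨m, hm⟩ := hn
    have hz : (0 : F) ∈ pad.map fun ξ => ξ (s.row n) := by
      rw [List.mem_map]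
      refine ⟨l m, ?_, hm⟩
      rw [hpad, List.mem_ofFn]
      refine ⟨⟨m, by omega⟩, ?_⟩
      congr 1
      ext
      simp
      omega
    rw [List.prod_eq_zero hz]
    simp
  have hrec : ∀ ξ, dec R (Q ξ) k i₀ = (alongLine w (f i₀)).eval (ξ (s.unitRow k)) := by
    intro ξ
    have h1 := h R hR (fun k => ξ (Pi.single (Sum.inl k) 1) • w)
      (fun t => ξ (Pi.single (Sum.inr t) 1) • w)
    have h2 := congrFun (congrFun h1 k) i₀
    rw [eval_alongLine]
    simp only [encode_smul] at h2
    rw [unitRow]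
    refine Eq.trans ?_ h2
    refine congrArg (fun y => dec R y k i₀) ?_
    funext n i
    simp only [Q, eval_alongLine]
    rfl
  have h1 := map_mixedDiff (((Pi.evalAddMonoidHom _ i₀).comp
      (Pi.evalAddMonoidHom (fun _ : Fin K => κ → F) k)).comp (dec R).toAddMonoidHom) Q pad 0
  have h2 := hdiff (s.unitRow k) i₀
  simp only [← hrec] at h2
  have h3 := h1.trans h2
  rw [hQ, map_zero] at h3
  have hfac : (d.factorial : F) ≠ 0 := by
    rw [← Finset.prod_range_add_one_eq_factorial, Nat.cast_prod, Finset.prod_ne_zero_iff]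
    exact fun j hj => hchar _ (by omega) (Finset.mem_range.mp hj)
  refine mul_ne_zero (mul_ne_zero hfac hw) ?_ h3.symm
  rw [Ne, List.prod_eq_zero_iff, List.mem_map]
  rintro ⟨ξ, hξ, h0⟩
  rw [hpad, List.mem_ofFn] at hξ
  obtain ⟨i, rfl⟩ := hξ
  exact hl _ h0

end LinearScheme

end Decoding

/-! ### Vanishing mutual information on finite types. -/

section MutualInformation

open MeasureTheory

theorem mutualInfo_eq_zero_iff {α β : Type*} [Finite α] [Finite β] (p : PMF (α × β)) :
    mutualInfo p = 0 ↔ ∀ a b, p (a, b) = p.map Prod.fst a * p.map Prod.snd b := by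
  let _ : MeasurableSpace α := ⊤
  let _ : MeasurableSpace β := ⊤
  have hs : ∀ x : α × β, MeasurableSet ({x} : Set (α × β)) := measurableSet_singleton
  rw [mutualInfo, InformationTheory.klDiv_eq_zero_iff, Measure.ext_iff_singleton]
  have h : ∀ x : α × β, (p.toMeasure {x} =
      ((p.map Prod.fst).toMeasure.prod (p.map Prod.snd).toMeasure) {x}) ↔
      p x = p.map Prod.fst x.1 * p.map Prod.snd x.2 := by
    rintro ⟨a, b⟩
    rw [PMF.toMeasure_apply_singleton _ _ (hs _), ← Set.singleton_prod_singleton,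
      Measure.prod_prod, PMF.toMeasure_apply_singleton _ _ (measurableSet_singleton a),
      PMF.toMeasure_apply_singleton _ _ (measurableSet_singleton b)]
  simp only [h, Prod.forall]

theorem bind_map_mk_apply {α β : Type*} (p : PMF α) (ν : α → PMF β) (a : α) (b : β) :
    (p.bind fun a => (ν a).map (Prod.mk a)) (a, b) = p a * ν a b := by
  rw [PMF.bind_apply, tsum_eq_single a]
  · rw [PMF.map_apply, tsum_eq_single b]
    · rw [if_pos rfl]
    · intro b' hb'
      rw [if_neg]
      simpa using hb'.symm
  · intro a' ha'
    rw [PMF.map_apply, ENNReal.tsum_eq_zero.mpr, mul_zero]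
    intro b'
    rw [if_neg]
    simp [ha'.symm]

theorem bind_map_mk_map_fst {α β : Type*} (p : PMF α) (ν : α → PMF β) :
    (p.bind fun a => (ν a).map (Prod.mk a)).map Prod.fst = p := by
  rw [PMF.map_bind]
  simp only [PMF.map_comp]
  have : ∀ a : α, (Prod.fst ∘ Prod.mk a : β → α) = Function.const β a := fun _ => rfl
  simp only [this, PMF.map_const, PMF.bind_pure]

theorem bind_map_mk_map_snd {α β : Type*} (p : PMF α) (ν : α → PMF β) :
    (p.bind fun a => (ν a).map (Prod.mk a)).map Prod.snd = p.bind ν := by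
  rw [PMF.map_bind]
  simp only [PMF.map_comp]
  have : ∀ a : α, (Prod.snd ∘ Prod.mk a : β → β) = id := fun _ => rfl
  simp only [this, PMF.map_id]

theorem uniformOfFintype_map_equiv {α : Type*} [Fintype α] [Nonempty α] (σ : α ≃ α) :
    (PMF.uniformOfFintype α).map σ = PMF.uniformOfFintype α := by
  ext a
  rw [PMF.map_apply, tsum_eq_single (σ.symm a)]
  · simp
  · intro b hb
    rw [if_neg]
    rintro rfl
    simp at hb

end MutualInformation

/-! ### Privacy as a linear condition on the encoding vectors. -/

namespace LinearScheme

variable {F : Type*} [Field F] {ι : Type*} {N K : ℕ}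

theorem encode_add (s : LinearScheme F N K) (D D' : Fin K → ι → F) (Z Z' : Fin s.keys → ι → F)
    (n : Fin N) : s.encode (D + D') (Z + Z') n = s.encode D Z n + s.encode D' Z' n := by
  simp only [encode, Pi.add_apply, smul_add, Finset.sum_add_distrib]
  abel

theorem encode_zero (s : LinearScheme F N K) (n : Fin N) :
    s.encode (0 : Fin K → ι → F) 0 n = 0 := by
  simp [encode]

/-- The law of the blocks held by the workers in `A`, given the data `D`. -/
def heldLaw [Finite F] [Finite ι] (s : LinearScheme F N K) (A : Finset (Fin N))
    (D : Fin K → ι → F) : PMF (A → ι → F) :=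
  letI : Fintype (Fin s.keys → ι → F) := Fintype.ofFinite _
  (PMF.uniformOfFintype (Fin s.keys → ι → F)).map fun Z n => s.encode D Z n

theorem jointLaw_eq [Finite F] [Finite ι] (s : LinearScheme F N K) (A : Finset (Fin N))
    (prior : PMF (Fin K → ι → F)) :
    s.jointLaw A prior = prior.bind fun D => (s.heldLaw A D).map (Prod.mk D) := by
  simp only [jointLaw, heldLaw, PMF.map_comp]
  rfl

/-- The blocks of colluding workers in a private scheme can be zero whatever the data are. -/
theorem IsPrivate.exists_encode_eq_zero [Finite ι] {s : LinearScheme F N K} {L : ℕ}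
    (h : s.IsPrivate ι L) {A : Finset (Fin N)} (hA : A.Nonempty) (hL : A.card ≤ L)
    (D : Fin K → ι → F) : ∃ Z : Fin s.keys → ι → F, ∀ n ∈ A, s.encode D Z n = 0 := by
  obtain ⟨_, h⟩ := h A hA hL
  let _ : Fintype (Fin K → ι → F) := Fintype.ofFinite _
  let _ : Fintype (Fin s.keys → ι → F) := Fintype.ofFinite _
  -- Under a uniform prior every data value has positive mass. The zero blocks occur for zero data,
  -- hence by independence for all data.
  have hm := (mutualInfo_eq_zero_iff _).mp (h (PMF.uniformOfFintype _))
  have hD := hm D 0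
  rw [jointLaw_eq, bind_map_mk_apply, bind_map_mk_map_fst, bind_map_mk_map_snd] at hD
  have h0 : (0 : A → ι → F) ∈ (s.heldLaw A (0 : Fin K → ι → F)).support := by
    rw [heldLaw, PMF.mem_support_map_iff]
    exact ⟨0, PMF.mem_support_uniformOfFintype _, funext fun n => s.encode_zero n⟩
  have h1 : (PMF.uniformOfFintype (Fin K → ι → F)).bind (s.heldLaw A) 0 ≠ 0 := by
    rw [← PMF.mem_support_iff, PMF.mem_support_bind_iff]
    exact ⟨0, PMF.mem_support_uniformOfFintype _, h0⟩
  have h2 : PMF.uniformOfFintype (Fin K → ι → F) D ≠ 0 :=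
    PMF.mem_support_uniformOfFintype D
  have h3 : (0 : A → ι → F) ∈ (s.heldLaw A D).support := by
    rw [PMF.mem_support_iff]
    intro h4
    rw [h4, mul_zero] at hD
    exact mul_ne_zero h2 h1 hD.symm
  rw [heldLaw, PMF.mem_support_map_iff] at h3
  obtain ⟨Z, -, hZ⟩ := h3
  exact ⟨Z, fun n hn => congrFun hZ ⟨n, hn⟩⟩

/-- Shifting the noise by `Z₀` removes the effect of the data on the held blocks and preserves the
uniform law, so their conditional law does not depend on the data. -/
theorem isPrivate_of_exists_encode_eq_zero [Finite ι] {s : LinearScheme F N K} {L : ℕ}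
    (hfin : 0 < L → Finite F)
    (h : ∀ A : Finset (Fin N), A.card ≤ L → ∀ D : Fin K → ι → F,
      ∃ Z : Fin s.keys → ι → F, ∀ n ∈ A, s.encode D Z n = 0) :
    s.IsPrivate ι L := by
  intro A hA hL
  have : Finite F := hfin ((Finset.card_pos.mpr hA).trans_le hL)
  refine ⟨this, fun prior => ?_⟩
  let _ : Fintype (Fin s.keys → ι → F) := Fintype.ofFinite _
  have hlaw : s.heldLaw A = fun _ => s.heldLaw A (0 : Fin K → ι → F) := by
    funext D
    obtain ⟨Z₀, hZ₀⟩ := h A hL D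
    rw [heldLaw, ← uniformOfFintype_map_equiv (Equiv.addLeft Z₀), PMF.map_comp, heldLaw]
    congr 1
    funext Z n
    have := s.encode_add D 0 Z₀ Z n
    rw [add_zero, hZ₀ n n.2, zero_add] at this
    exact this
  rw [mutualInfo_eq_zero_iff]
  intro D Y
  rw [jointLaw_eq, bind_map_mk_apply, bind_map_mk_map_fst, bind_map_mk_map_snd, hlaw,
    PMF.bind_const]

theorem IsPrivate.disjoint_span [Finite ι] [Nonempty ι] {s : LinearScheme F N K} {L : ℕ}
    (h : s.IsPrivate ι L) (A : Finset (Fin N)) (hL : A.card ≤ L) :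
    Disjoint (Submodule.span F (s.row '' A)) (Submodule.span F (Set.range s.unitRow)) := by
  classical
  rcases A.eq_empty_or_nonempty with rfl | hA
  · simp
  rw [Submodule.disjoint_def]
  intro x hx hxP
  have hr : ∀ t, x (Sum.inr t) = 0 := by
    intro t
    have : Submodule.span F (Set.range s.unitRow) ≤
        (LinearMap.proj (Sum.inr t) : (Fin K ⊕ Fin s.keys → F) →ₗ[F] F).ker := by
      rw [Submodule.span_le]
      rintro _ ⟨k, rfl⟩
      simp [unitRow]
    exact this hxP
  have hl : ∀ k, x (Sum.inl k) = 0 := by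
    intro k
    obtain ⟨i⟩ := ‹Nonempty ι›
    obtain ⟨Z, hZ⟩ := h.exists_encode_eq_zero hA hL (Pi.single k fun _ : ι => (1 : F))
    -- The noise hiding the unit data block gives a functional that vanishes at the rows in `A` and
    -- reads off coordinate `k` of vectors without noise part.
    let ψ : (Fin K ⊕ Fin s.keys → F) →ₗ[F] F :=
      LinearMap.proj (Sum.inl k) + ∑ t, Z t i • LinearMap.proj (Sum.inr t)
    have hψ : ∀ y : Fin K ⊕ Fin s.keys → F,
        ψ y = y (Sum.inl k) + ∑ t, Z t i * y (Sum.inr t) := fun y => by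
      simp [ψ]
    have hspan : Submodule.span F (s.row '' A) ≤ ψ.ker := by
      rw [Submodule.span_le]
      rintro _ ⟨n, hn, rfl⟩
      have := congrFun (hZ n hn) i
      simp only [encode, Pi.add_apply, Finset.sum_apply, Pi.smul_apply, smul_eq_mul,
        Pi.zero_apply] at this
      rw [SetLike.mem_coe, LinearMap.mem_ker, hψ, ← this]
      congr 1
      · rw [Finset.sum_eq_single k]
        · simp [row]
        · intro b _ hb; simp [Pi.single_eq_of_ne hb]
        · simp
      · exact Finset.sum_congr rfl fun t _ => mul_comm _ _
    have h0 := LinearMap.mem_ker.mp (hspan hx)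
    rw [hψ] at h0
    simpa [hr] using h0
  funext j
  rcases j with k | t
  · exact hl k
  · exact hr t

end LinearScheme

/-! ### Choosing points and functionals over a large field. -/

section Points

theorem exists_injective_fin {F : Type*} {M : ℕ} (hcard : (M : ℕ∞) ≤ ENat.card F) :
    ∃ v : Fin M → F, Function.Injective v := by
  rcases finite_or_infinite F with hF | hF
  · let _ := Fintype.ofFinite F
    rw [ENat.card_eq_coe_fintype_card, Nat.cast_le] at hcard
    exact ⟨fun i => (Fintype.equivFin F).symm (Fin.castLE hcard i),
      (Equiv.injective _).comp (Fin.castLE_injective _)⟩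
  · exact ⟨fun i => Infinite.natEmbedding F i,
      (Infinite.natEmbedding F).injective.comp Fin.val_injective⟩

/-- Over a large field, finitely many vectors outside a subspace `P` are avoided by the kernel of
some functional that vanishes on `P`. -/
theorem exists_dual_ne_zero_of_notMem {F V η : Type*} [Field F] [AddCommGroup V] [Module F V]
    (P : Submodule F V) (g : η → V) (T : Finset F) (E : Finset η) (hE : E.card < T.card)
    (hg : ∀ n ∈ E, g n ∉ P) :
    ∃ φ : Module.Dual F V, P ≤ φ.ker ∧ ∀ n ∈ E, φ (g n) ≠ 0 := by
  classical
  induction E using Finset.induction_on with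
  | empty => exact ⟨0, by simp, by simp⟩
  | insert n E hn ih =>
    rw [Finset.card_insert_of_notMem hn] at hE
    obtain ⟨φ, hφP, hφ⟩ := ih (by omega) fun m hm => hg m (Finset.mem_insert_of_mem hm)
    by_cases h0 : φ (g n) = 0
    · obtain ⟨ψ, hψn, hψP⟩ := Submodule.exists_le_ker_of_notMem
        (hg n (Finset.mem_insert_self _ _))
      -- Each earlier member excludes at most one `t`, and the new one excludes only `0`.
      obtain ⟨t, -, ht⟩ : ∃ t ∈ T, t ∉ insert 0 (E.image fun m => -(φ (g m) / ψ (g m))) := by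
        refine Finset.exists_mem_notMem_of_card_lt_card ?_
        exact (Finset.card_insert_le _ _).trans_lt
          ((Nat.add_le_add_right Finset.card_image_le 1).trans_lt hE)
      simp only [Finset.mem_insert, Finset.mem_image, not_or, not_exists, not_and] at ht
      refine ⟨φ + t • ψ, fun x hx => ?_, fun m hm => ?_⟩
      · have h1 := LinearMap.mem_ker.mp (hφP hx)
        have h2 := LinearMap.mem_ker.mp (hψP hx)
        simp [LinearMap.mem_ker, h1, h2]
      · rw [LinearMap.add_apply, LinearMap.smul_apply, smul_eq_mul]
        rcases Finset.mem_insert.mp hm with rfl | hm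
        · rw [h0, zero_add]
          exact mul_ne_zero ht.1 hψn
        · intro h1
          by_cases h2 : ψ (g m) = 0
          · rw [h2, mul_zero, add_zero] at h1
            exact hφ m hm h1
          · refine ht.2 m hm ?_
            field_simp
            linear_combination -h1
    · refine ⟨φ, hφP, fun m hm => ?_⟩
      rcases Finset.mem_insert.mp hm with rfl | hm
      · exact h0
      · exact hφ m hm

end Points

/-! ### Upper bounds on the number of data blocks. -/

section Converse

open Finset Module

variable {F : Type*} [Field F] {ι κ : Type*} {N K : ℕ}

namespace LinearScheme

theorem linearIndependent_unitRow (s : LinearScheme F N K) :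
    LinearIndependent F s.unitRow := by
  have h := (Pi.basisFun F (Fin K ⊕ Fin s.keys)).linearIndependent.comp Sum.inl
    Sum.inl_injective
  convert! h using 1
  funext k
  simp [unitRow]

theorem finrank_span_unitRow (s : LinearScheme F N K) :
    finrank F (Submodule.span F (Set.range s.unitRow)) = K := by
  rw [finrank_span_eq_card s.linearIndependent_unitRow, Fintype.card_fin]

/-- The converse bound without privacy. -/
theorem card_le_of_recoversWith [Finite ι] [Fintype κ] {s : LinearScheme F N K}
    {f : κ → MvPolynomial ι F} {S d : ℕ} (hd : 1 ≤ d) (hdeg : polyDegree f = d) (hS : S ≤ N)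
    (hchar : ∀ j : ℕ, 1 ≤ j → j ≤ d → (j : F) ≠ 0) {dec : Decoder F κ N K}
    (h : s.RecoversWith f S dec) (hK : 0 < K) :
    min d (S + 1) * K + (S + 1) ≤ N + min d (S + 1) := by
  -- The covering bound needs no more functionals than `S + 1`. The two cases of the minimum yield
  -- the two terms of the maximum in the formula for `L = 0`.
  have hc : 0 < min d (S + 1) := by omega
  let q : (Fin K ⊕ Fin s.keys → F) →ₗ[F] (Fin K → F) := LinearMap.funLeft F F Sum.inl
  have hq : ∀ k, q (s.unitRow k) = Pi.basisFun F (Fin K) k := by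
    intro k
    funext i
    simp [q, unitRow, LinearMap.funLeft_apply, Pi.single_apply]
  have h1 := card_ge_of_uncoverable_span (F := F) (n := K) (d := min d (S + 1)) (s := S + 1)
    hc (min_le_right _ _) hK (e := Pi.basisFun F (Fin K)) (g := fun n => q (s.row n))
    (E := univ) (by simp) (Pi.basisFun F (Fin K)).span_eq (fun k => by
      rw [← hq]
      exact (uncoverable_of_recoversWith hd hdeg hS hchar h hc (min_le_left _ _) k).map q)
  simpa using h1

/-- The converse bound with privacy. -/
theorem card_le_of_isPrivate [Finite ι] [Fintype κ] {s : LinearScheme F N K}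
    {f : κ → MvPolynomial ι F} {S L d : ℕ} (hd : 1 ≤ d) (hdeg : polyDegree f = d) (hS : S ≤ N)
    (hchar : ∀ j : ℕ, 1 ≤ j → j ≤ d → (j : F) ≠ 0) {dec : Decoder F κ N K}
    (h : s.RecoversWith f S dec) (hL : 0 < L) (hpriv : s.IsPrivate ι L) (hK : 0 < K)
    (T : Finset F) (hT : N < T.card) :
    d * (K + L) + 1 ≤ N - S + d := by
  classical
  have hι : Nonempty ι := by
    by_contra hι
    rw [not_nonempty_iff] at hι
    have : polyDegree f = 0 := by
      rw [polyDegree, ← Nat.bot_eq_zero, Finset.sup_eq_bot_iff]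
      intro i _
      rw [MvPolynomial.eq_C_of_isEmpty (f i), MvPolynomial.totalDegree_C]
      rfl
    omega
  obtain ⟨R, -, hR⟩ := exists_subset_card_eq (s := (univ : Finset (Fin N))) (n := N - S)
    (by simp)
  -- Restricting to `N - S` workers leaves one uncovered member. Nonzero rows lie outside the data
  -- span by privacy against one worker, so some `φ` separates them all from it.
  set E := R.filter fun n => s.row n ≠ 0 with hE
  have hdis := hpriv.disjoint_span
  have hnot : ∀ n ∈ E, s.row n ∉ Submodule.span F (Set.range s.unitRow) := by
    intro n hn hmem
    have h1 := hdis {n} (by rw [card_singleton]; omega)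
    refine (mem_filter.mp hn).2 (Submodule.disjoint_def.mp h1 _ ?_ hmem)
    exact Submodule.subset_span ⟨n, by simp, rfl⟩
  have hER : E.card ≤ N - S := hR ▸ card_le_card (filter_subset _ _)
  obtain ⟨φ, hφP, hφ⟩ := exists_dual_ne_zero_of_notMem _ s.row T E (by omega) hnot
  have hunc : ∀ k, Uncoverable (F := F) d 1 E s.row (s.unitRow k) := by
    intro k l hl
    have h1 := uncoverable_of_recoversWith hd hdeg hS hchar h hd le_rfl k l hl
    rw [Nat.one_le_iff_ne_zero, ← Nat.pos_iff_ne_zero, card_pos]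
    have h2 : (Rᶜ).card < (univ.filter fun n => ∀ i, l i (s.row n) ≠ 0).card := by
      rw [card_compl, Fintype.card_fin, hR]
      refine lt_of_lt_of_le ?_ h1
      omega
    obtain ⟨n, hn, hnR⟩ := exists_mem_notMem_of_card_lt_card h2
    rw [mem_compl, not_not] at hnR
    have hn' := (mem_filter.mp hn).2
    exact ⟨n, mem_filter.mpr ⟨mem_filter.mpr ⟨hnR, fun h0 => hn' ⟨0, hd⟩ (by simp [h0])⟩, hn'⟩⟩
  have h1 := card_ge_of_uncoverable_private (F := F) (L := L) hd hL (φ := φ) rfl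
    ⟨⟨0, hK⟩, s.linearIndependent_unitRow.ne_zero _⟩
    (fun k => LinearMap.mem_ker.mp (hφP (Submodule.subset_span ⟨k, rfl⟩))) hφ
    (fun A _ hA => hdis A hA) hunc
  rw [finrank_span_unitRow] at h1
  omega

end LinearScheme

end Converse

/-! ### APCC decodes and is private. -/

section Achievability

open Polynomial

variable {F : Type*} [Field F] {ι κ : Type*} {N K L : ℕ}

theorem encode_apcc (α : Fin (K + L) → F) (β : Fin N → F) (D : Fin K → ι → F)
    (Z : Fin L → ι → F) (n : Fin N) (j : ι) :
    (apcc α β).encode D Z n j =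
      (Lagrange.interpolate Finset.univ α fun m => Fin.append D Z m j).eval (β n) := by
  rw [Lagrange.interpolate_apply, eval_finsetSum, Fin.sum_univ_add]
  simp only [LinearScheme.encode, apcc, Pi.add_apply, Finset.sum_apply, Pi.smul_apply,
    smul_eq_mul, eval_mul, eval_C, Fin.append_left, Fin.append_right, mul_comm]
  rfl

theorem apcc_recoversWith [Fintype κ] {f : κ → MvPolynomial ι F} {S : ℕ}
    {α : Fin (K + L) → F} {β : Fin N → F} (hα : Function.Injective α) (hβ : Function.Injective β)
    (h : polyDegree f * (K + L - 1) + 1 ≤ N - S) :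
    (apcc α β).RecoversWith f S (apccDecoder κ α β) := by
  intro R hR D Z
  funext k i
  have hkL : 0 < K + L := by have := k.isLt; omega
  set g : ι → F[X] := fun j =>
    Lagrange.interpolate Finset.univ α fun m => Fin.append D (Z : Fin L → ι → F) m j with hg
  set p : F[X] := MvPolynomial.aeval g (f i) with hp
  have heval : ∀ x, p.eval x = MvPolynomial.eval (fun j => (g j).eval x) (f i) := by
    intro x
    rw [hp, ← coe_evalRingHom, MvPolynomial.map_aeval, MvPolynomial.eval]
    congr 1
    ext j
    · simp
    · simp
  have hgdeg : ∀ j, (g j).natDegree ≤ K + L - 1 := by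
    intro j
    have h1 := Lagrange.degree_interpolate_lt (s := Finset.univ) (v := α)
      (fun m => Fin.append D (Z : Fin L → ι → F) m j) hα.injOn
    rw [Finset.card_univ, Fintype.card_fin] at h1
    by_cases h0 : g j = 0
    · simp [h0]
    · exact Nat.le_sub_one_of_lt ((natDegree_lt_iff_degree_lt h0).mpr h1)
  have hpdeg : p.natDegree ≤ polyDegree f * (K + L - 1) :=
    MvPolynomial.aeval_natDegree_le (f i)
      (Finset.le_sup (f := fun i => (f i).totalDegree) (Finset.mem_univ i)) g hgdeg
  have hinterp : p = Lagrange.interpolate R β fun n => p.eval (β n) := by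
    refine Lagrange.eq_interpolate hβ.injOn ?_
    rw [hR]
    refine degree_le_natDegree.trans_lt ?_
    exact_mod_cast (by omega : p.natDegree < N - S)
  have hval : ∀ n, polyFun f ((apcc α β).encode D Z n) i = p.eval (β n) := by
    intro n
    rw [heval, polyFun]
    congr 2
    funext j
    exact encode_apcc α β D Z n j
  have hD : polyFun f (D k) i = p.eval (α (Fin.castAdd L k)) := by
    rw [heval, polyFun]
    congr 2
    funext j
    rw [hg, Lagrange.eval_interpolate_at_node _ hα.injOn (Finset.mem_univ _)]
    exact (congrFun (Fin.append_left D (Z : Fin L → ι → F) k) j).symm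
  rw [hD, hinterp, Lagrange.interpolate_apply, eval_finsetSum, ← Finset.sum_coe_sort R]
  simp only [apccDecoder, LinearMap.pi_apply, LinearMap.sum_apply, LinearMap.smul_apply,
    LinearMap.proj_apply, Finset.sum_apply, Pi.smul_apply, smul_eq_mul, hval, eval_mul, eval_C,
    mul_comm]

/-- The polynomial through the data at their nodes and through zero at the points of `A` has degree
below `K + A.card ≤ K + L`. It is therefore an encoding polynomial, and its values at the remaining
nodes are the noise that makes the blocks zero. -/
theorem apcc_isPrivate [Finite ι] {α : Fin (K + L) → F} {β : Fin N → F} (h : ApccPoints α β)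
    (hfin : 0 < L → Finite F) : (apcc α β).IsPrivate ι L := by
  classical
  refine LinearScheme.isPrivate_of_exists_encode_eq_zero hfin fun A hA D => ?_
  obtain ⟨hα, hβ, hαβ⟩ := h
  let v : Fin K ⊕ A → F := Sum.elim (fun k => α (Fin.castAdd L k)) fun n => β n
  have hv : Function.Injective v := by
    refine Function.Injective.sumElim (hα.comp (Fin.castAdd_injective K L))
      (hβ.comp Subtype.val_injective) fun k n heq => ?_
    have : 0 < A.card := Finset.card_pos.mpr ⟨n, n.2⟩
    exact hαβ (by omega) n k heq.symm
  let q : ι → F[X] := fun j =>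
    Lagrange.interpolate Finset.univ v (Sum.elim (fun k => D k j) fun _ => 0)
  have hq : ∀ j, q j = Lagrange.interpolate Finset.univ α fun m => (q j).eval (α m) := by
    intro j
    refine Lagrange.eq_interpolate hα.injOn ?_
    refine (Lagrange.degree_interpolate_lt _ hv.injOn).trans_le ?_
    simp only [Finset.card_univ, Fintype.card_sum, Fintype.card_fin, Fintype.card_coe]
    exact_mod_cast Nat.add_le_add_left hA K
  let Z : Fin L → ι → F := fun t j => (q j).eval (α (Fin.natAdd K t))
  refine ⟨Z, fun n hn => funext fun j => ?_⟩
  rw [encode_apcc]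
  have hval : (fun m => Fin.append D Z m j) = fun m => (q j).eval (α m) := by
    funext m
    refine Fin.addCases (fun k => ?_) (fun t => ?_) m
    · rw [Fin.append_left]
      have := Lagrange.eval_interpolate_at_node (s := Finset.univ) (v := v)
        (Sum.elim (fun k => D k j) fun _ => 0) hv.injOn (Finset.mem_univ (Sum.inl k))
      exact this.symm
    · rw [Fin.append_right]
  rw [hval, ← hq]
  exact Lagrange.eval_interpolate_at_node (s := Finset.univ) (v := v)
    (Sum.elim (fun k => D k j) fun _ => 0) hv.injOn (Finset.mem_univ (Sum.inr ⟨n, hn⟩))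

theorem exists_apccPoints {F : Type*} {N K L : ℕ} (hK : K + L ≤ N) (hcard : ((2 * N : ℕ) : ℕ∞) ≤ ENat.card F) :
    ∃ (α : Fin (K + L) → F) (β : Fin N → F), ApccPoints α β := by
  obtain ⟨v, hv⟩ := exists_injective_fin hcard
  refine ⟨fun i => v ⟨i, by omega⟩, fun n => v ⟨N + n, by omega⟩, fun i j hij => ?_,
    fun i j hij => ?_, fun _ n k hnk => ?_⟩
  · have := congrArg Fin.val (hv hij)
    exact Fin.ext this
  · have := congrArg Fin.val (hv hij)
    simp only at this
    exact Fin.ext (by omega)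
  · have := congrArg Fin.val (hv hnk)
    simp only [Fin.val_castAdd] at this
    omega

theorem apccSolves_of_degree [Finite ι] [Fintype κ] {f : κ → MvPolynomial ι F} {S : ℕ}
    (h : polyDegree f * (K + L - 1) + 1 ≤ N - S) (hKL : K + L ≤ N)
    (hcard : ((2 * N : ℕ) : ℕ∞) ≤ ENat.card F) (hfin : 0 < L → Finite F) :
    ApccSolves f N S L K :=
  Or.inl ⟨exists_apccPoints hKL hcard, fun _ _ hp =>
    ⟨apcc_recoversWith hp.1 hp.2.1 h, apcc_isPrivate hp hfin⟩⟩

/-- The workers `k + K * t` with `t ≤ S` all hold block `k`, and `S` stragglers cannot remove all of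
them. -/
theorem uncoded_isFeasible [Finite ι] (f : κ → MvPolynomial ι F) {S : ℕ} (hS : S ≤ N)
    (hK : 0 < K) (h : K * (S + 1) ≤ N) {α : Fin (K + 0) → F} (hα : Function.Injective α) :
    (apcc α (uncodedPoints N hK α)).IsFeasible f S 0 := by
  classical
  have henc : ∀ (D : Fin K → ι → F) (Z : Fin 0 → ι → F) (n : Fin N),
      (apcc α (uncodedPoints N hK α)).encode D Z n = D ⟨n % K, Nat.mod_lt _ hK⟩ := by
    intro D Z n
    funext j
    rw [encode_apcc, uncodedPoints,
      Lagrange.eval_interpolate_at_node _ hα.injOn (Finset.mem_univ _), Fin.append_left]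
  have hex : ∀ R : Finset (Fin N), R.card = N - S → ∀ k : Fin K,
      ∃ n : R, ((n : Fin N) : ℕ) % K = k := by
    intro R hR k
    let c : Fin (S + 1) → Fin N := fun t => ⟨k + K * t, by
      have h1 : K * ((t : ℕ) + 1) ≤ K * (S + 1) := Nat.mul_le_mul_left K t.isLt
      have h2 := k.isLt
      rw [mul_add, mul_one] at h1
      omega⟩
    have hc : Function.Injective c := by
      intro a b hab
      have h1 := congrArg Fin.val hab
      simp only [c, Nat.add_left_cancel_iff] at h1
      exact Fin.ext (Nat.eq_of_mul_eq_mul_left hK h1)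
    by_contra! hno
    have hdis : Disjoint R (Finset.univ.image c) := by
      rw [Finset.disjoint_left]
      intro n hn hn'
      obtain ⟨t, -, rfl⟩ := Finset.mem_image.mp hn'
      refine hno ⟨_, hn⟩ ?_
      simp [c, Nat.mod_eq_of_lt k.isLt]
    have h1 := Finset.card_le_univ (R ∪ Finset.univ.image c)
    rw [Finset.card_union_of_disjoint hdis, Finset.card_image_of_injective _ hc, hR] at h1
    simp only [Finset.card_univ, Fintype.card_fin] at h1
    omega
  refine ⟨⟨fun R => LinearMap.pi fun k =>
    -- The value `0` is never used when `R` has `N - S` members.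
    if h : ∃ n : R, ((n : Fin N) : ℕ) % K = k then LinearMap.proj h.choose else 0, ?_⟩, ?_⟩
  · intro R hR D Z
    funext k
    have hk := hex R hR k
    rw [LinearMap.pi_apply, dif_pos hk, LinearMap.proj_apply]
    refine congrArg (polyFun f) ((henc D Z _).trans ?_)
    congr 1
    exact Fin.ext hk.choose_spec
  · intro A hA hA0
    have := Finset.card_pos.mpr hA
    omega

theorem apccSolves_uncoded [Finite ι] (f : κ → MvPolynomial ι F) {S : ℕ} (hS : S ≤ N)
    (hK : 0 < K) (h : K * (S + 1) ≤ N) (hcard : ((2 * N : ℕ) : ℕ∞) ≤ ENat.card F) :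
    ApccSolves f N S 0 K := by
  refine Or.inr ⟨rfl, hK, ?_, fun α hα => uncoded_isFeasible f hS hK h hα⟩
  have hKN : K + 0 ≤ N := by
    have := Nat.le_mul_of_pos_right K (show 0 < S + 1 by omega)
    omega
  obtain ⟨α, -, hα, -⟩ := exists_apccPoints (L := 0) hKN hcard
  exact ⟨α, hα⟩

theorem ApccSolves.mem_encodingRates [Finite ι] {f : κ → MvPolynomial ι F} {S : ℕ}
    (h : ApccSolves f N S L K) (hK : 0 < K) :
    (K : ℝ) / ((N : ℝ) - S) ∈ encodingRates f N S L := by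
  rcases h with ⟨⟨α, β, hp⟩, h⟩ | ⟨rfl, hK', ⟨α, hα⟩, h⟩
  · obtain ⟨h1, h2⟩ := h α β hp
    exact ⟨K, apcc α β, hK, ⟨⟨_, h1⟩, h2⟩, rfl⟩
  · exact ⟨K, _, hK, h α hα, rfl⟩

end Achievability

/-! ### Rounding, and matching the two bounds. -/

section Capacity

variable {F : Type*} [Field F] {ι κ : Type*} {N S L d K : ℕ}

/-- Here `(N - S) * C₀ = (N - S - 1) / d + 1 - L`, and `h1`, `h2` say that `K` is the largest
integer not exceeding it. -/
theorem floor_capacityFormula_of_pos (hd : 1 ≤ d) (hS : S < N) (hL : 0 < L)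
    (h1 : d * (K + L) + 1 ≤ N - S + d) (h2 : N - S < d * (K + L) + 1) :
    ⌊((N : ℝ) - S) * capacityFormula N S L d⌋ = (K : ℤ) := by
  have hM : (0 : ℝ) < (N : ℝ) - S := sub_pos.mpr (by exact_mod_cast hS)
  have hd' : (0 : ℝ) < d := by exact_mod_cast hd
  have h1' : (d : ℝ) * (K + L) + 1 ≤ (N : ℝ) - S + d := by
    rw [← Nat.cast_sub hS.le]; exact_mod_cast h1
  have h2' : (N : ℝ) - S < (d : ℝ) * (K + L) + 1 := by
    rw [← Nat.cast_sub hS.le]; exact_mod_cast h2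
  have he : ((N : ℝ) - S) * capacityFormula N S L d =
      ((N : ℝ) - S - d * ((L : ℝ) - 1) - 1) / d := by
    rw [capacityFormula, if_pos hL]
    field_simp
  rw [he, Int.floor_eq_iff, le_div_iff₀ hd', div_lt_iff₀ hd']
  push_cast
  constructor <;> linarith

theorem floor_capacityFormula_zero (hd : 1 ≤ d) (hS : S < N) :
    ⌊((N : ℝ) - S) * capacityFormula N S 0 d⌋ =
      ((max ((N - S - 1) / d + 1) (N / (S + 1)) : ℕ) : ℤ) := by
  have hM : (0 : ℝ) < (N : ℝ) - S := sub_pos.mpr (by exact_mod_cast hS)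
  have hd' : (0 : ℝ) < d := by exact_mod_cast hd
  have hS' : (0 : ℝ) < (S : ℝ) + 1 := by positivity
  have he : ((N : ℝ) - S) * capacityFormula N S 0 d =
      max (((N - S - 1 + d : ℕ) : ℝ) / (d : ℕ)) ((N : ℝ) / (S + 1 : ℕ)) := by
    rw [capacityFormula, if_neg (lt_irrefl 0), mul_max_of_nonneg _ _ hM.le]
    have : ((N - S - 1 + d : ℕ) : ℝ) = (N : ℝ) - S + d - 1 := by
      rw [Nat.cast_add, Nat.cast_sub (by omega), Nat.cast_sub hS.le]; push_cast; ring
    rw [this]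
    push_cast
    congr 1 <;> field_simp
  rw [he, Monotone.map_max Int.floor_mono, Nat.cast_max]
  congr 1
  · rw [← Nat.add_div_right _ hd, ← Nat.floor_div_eq_div (K := ℝ)]
    exact (Int.natCast_floor_eq_floor (by positivity)).symm
  · rw [← Nat.floor_div_eq_div (K := ℝ)]
    exact (Int.natCast_floor_eq_floor (by positivity)).symm

theorem isGreatest_encodingRates [Finite ι] {f : κ → MvPolynomial ι F} (hS : S < N)
    (hK : 0 < K) (h : ApccSolves f N S L K)
    (hmax : ∀ (K' : ℕ) (s : LinearScheme F N K'), 0 < K' → s.IsFeasible f S L → K' ≤ K) :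
    IsGreatest (encodingRates f N S L) ((K : ℝ) / ((N : ℝ) - S)) := by
  refine ⟨h.mem_encodingRates hK, ?_⟩
  rintro _ ⟨K', s, hK', hs, rfl⟩
  have hM : (0 : ℝ) < (N : ℝ) - S := sub_pos.mpr (by exact_mod_cast hS)
  have : (K' : ℝ) ≤ K := by exact_mod_cast hmax K' s hK' hs
  gcongr

/-- The optimal number of data blocks: APCC attains it, no scheme exceeds it, and it is the
rounded closed form. -/
theorem exists_optimal_card [Fintype ι] [Fintype κ] {f : κ → MvPolynomial ι F}
    (hd : 1 ≤ d) (hdeg : polyDegree f = d) (hS : S < N)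
    (hchar : ∀ j : ℕ, 1 ≤ j → j ≤ d → (j : F) ≠ 0)
    (hcard : ((2 * N : ℕ) : ℕ∞) ≤ ENat.card F) (hfin : 0 < L → Finite F)
    (hN : S + d * L + 1 ≤ N) :
    ∃ K : ℕ, 0 < K ∧ ApccSolves f N S L K ∧
      (∀ (K' : ℕ) (s : LinearScheme F N K'), 0 < K' → s.IsFeasible f S L → K' ≤ K) ∧
      ⌊((N : ℝ) - S) * capacityFormula N S L d⌋ = (K : ℤ) := by
  classical
  have hq1 : d * ((N - S - 1) / d) ≤ N - S - 1 := Nat.mul_div_le _ _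
  have hq2 : N - S - 1 < d * ((N - S - 1) / d + 1) := Nat.lt_mul_div_succ _ hd
  have hq3 : (N - S - 1) / d ≤ N - S - 1 := Nat.div_le_self _ _
  have hLq : L ≤ (N - S - 1) / d := by
    rw [Nat.le_div_iff_mul_le hd, mul_comm]
    omega
  -- The largest degree of an encoding polynomial whose composite with `f` can be interpolated from
  -- `N - S` results in general.
  set q := (N - S - 1) / d with hq
  rcases Nat.eq_zero_or_pos L with rfl | hL
  · refine ⟨max (q + 1) (N / (S + 1)), by omega, ?_, fun K' s hK' hs => ?_,
      floor_capacityFormula_zero hd hS⟩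
    · rcases le_total (N / (S + 1)) (q + 1) with h | h
      · rw [max_eq_left h]
        refine apccSolves_of_degree ?_ (by omega) hcard hfin
        rw [hdeg]
        simp only [Nat.add_zero, Nat.add_sub_cancel]
        omega
      · rw [max_eq_right h]
        exact apccSolves_uncoded f hS.le (by omega) (Nat.div_mul_le_self _ _) hcard
    · obtain ⟨⟨dec, hdec⟩, -⟩ := hs
      have h1 := LinearScheme.card_le_of_recoversWith hd hdeg hS.le hchar hdec hK'
      rcases le_total d (S + 1) with h | h
      · rw [min_eq_left h] at h1
        refine le_max_of_le_left ?_
        have h2 : d * K' < d * (q + 1 + 1) := by rw [mul_add d (q + 1) 1]; omega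
        exact Nat.le_of_lt_succ (Nat.lt_of_mul_lt_mul_left h2)
      · rw [min_eq_right h] at h1
        refine le_max_of_le_right ?_
        rw [Nat.le_div_iff_mul_le (by omega), mul_comm]
        omega
  · have hK : q + 1 - L + L = q + 1 := by omega
    refine ⟨q + 1 - L, by omega, ?_, fun K' s hK' hs => ?_,
      floor_capacityFormula_of_pos hd hS hL ?_ ?_⟩
    · refine apccSolves_of_degree ?_ (by omega) hcard hfin
      rw [hdeg, hK, Nat.add_sub_cancel]
      omega
    · obtain ⟨⟨dec, hdec⟩, hpriv⟩ := hs
      obtain ⟨v, hv⟩ := exists_injective_fin hcard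
      have h1 := LinearScheme.card_le_of_isPrivate hd hdeg hS.le hchar hdec hL hpriv hK'
        (Finset.univ.image v) (by
          rw [Finset.card_image_of_injective _ hv, Finset.card_univ, Fintype.card_fin]; omega)
      have h2 : d * (K' + L) < d * (q + 1 + 1) := by rw [mul_add d (q + 1) 1]; omega
      have := Nat.lt_of_mul_lt_mul_left h2
      omega
    · rw [hK, mul_add]; omega
    · rw [hK]; omega

theorem encodingRates_eq_empty [Fintype ι] [Fintype κ] {f : κ → MvPolynomial ι F}
    (hd : 1 ≤ d) (hdeg : polyDegree f = d) (hS : S < N)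
    (hchar : ∀ j : ℕ, 1 ≤ j → j ≤ d → (j : F) ≠ 0)
    (hcard : ((2 * N : ℕ) : ℕ∞) ≤ ENat.card F) (hN : N < S + d * L + 1) :
    encodingRates f N S L = ∅ := by
  classical
  rcases Nat.eq_zero_or_pos L with rfl | hL
  · omega
  rw [Set.eq_empty_iff_forall_notMem]
  rintro _ ⟨K, s, hK, ⟨⟨dec, hdec⟩, hpriv⟩, rfl⟩
  obtain ⟨v, hv⟩ := exists_injective_fin hcard
  have h1 := LinearScheme.card_le_of_isPrivate hd hdeg hS.le hchar hdec hL hpriv hK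
    (Finset.univ.image v) (by
      rw [Finset.card_image_of_injective _ hv, Finset.card_univ, Fintype.card_fin]; omega)
  -- Even one data block makes the private bound demand `d * L + 1 ≤ N - S`.
  have h2 : d * 1 ≤ d * K := Nat.mul_le_mul_left d hK
  rw [mul_add] at h1
  omega

end Capacity

end CodedComputing

end

theorem theorem1 {F : Type*} [Field F] {ι κ : Type*} [Fintype ι] [Fintype κ]
    (N S L d : ℕ) (f : κ → MvPolynomial ι F)
    (hd : 1 ≤ d) (hdeg : CodedComputing.polyDegree f = d) (hS : S < N)
    (hchar : ∀ j : ℕ, 1 ≤ j → j ≤ d → (j : F) ≠ 0)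
    (hcard : ((2 * N : ℕ) : ℕ∞) ≤ ENat.card F)
    (hfin : 0 < L → Finite F) :
    (S + d * L + 1 ≤ N →
      IsGreatest (CodedComputing.encodingRates f N S L) (CodedComputing.capacity f N S L) ∧
      CodedComputing.capacity f N S L =
        (⌊((N : ℝ) - S) * CodedComputing.capacityFormula N S L d⌋ : ℝ) / ((N : ℝ) - S) ∧
      (CodedComputing.capacity f N S L = CodedComputing.capacityFormula N S L d ↔
        ∃ m : ℤ, ((N : ℝ) - S) * CodedComputing.capacityFormula N S L d = m) ∧
      ∃ K : ℕ, 0 < K ∧ CodedComputing.ApccSolves f N S L K ∧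
        CodedComputing.capacity f N S L = (K : ℝ) / ((N : ℝ) - S)) ∧
    (N < S + d * L + 1 → CodedComputing.encodingRates f N S L = ∅) := by
  refine ⟨fun hN => ?_, CodedComputing.encodingRates_eq_empty hd hdeg hS hchar hcard⟩
  obtain ⟨K, hK, hsolves, hmax, hfloor⟩ :=
    CodedComputing.exists_optimal_card hd hdeg hS hchar hcard hfin hN
  have hM : (0 : ℝ) < (N : ℝ) - S := sub_pos.mpr (by exact_mod_cast hS)
  have hgreat := CodedComputing.isGreatest_encodingRates hS hK hsolves hmax
  have hcap : CodedComputing.capacity f N S L = (K : ℝ) / ((N : ℝ) - S) := hgreat.csSup_eq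
  have hcap' : CodedComputing.capacity f N S L =
      (⌊((N : ℝ) - S) * CodedComputing.capacityFormula N S L d⌋ : ℝ) / ((N : ℝ) - S) := by
    rw [hcap, hfloor, Int.cast_natCast]
  refine ⟨hcap ▸ hgreat, hcap', ⟨fun h => ⟨K, ?_⟩, ?_⟩, K, hK, hsolves, hcap⟩
  · rw [← h, hcap, mul_div_cancel₀ _ hM.ne', Int.cast_natCast]
  · rintro ⟨m, hm⟩
    rw [hcap', hm, Int.floor_intCast, ← hm, mul_div_cancel_left₀ _ hM.ne']
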